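/- Let $G$ be a $3$-graph, that is, a finite vertex set $V$ together with a set $E(G)$ of $3$-element subsets of $V$ (the edges). For a weighting $x=(x_v)_{v\in V}$ in the simplex $S_V=\{x\in\mathbb{R}^V : x_v\ge 0 \text{ for all } v,\ \sum_{v\in V}x_v=1\}$ put $\lambda(G,x)=\sum_{\{u,v,w\}\in E(G)}x_ux_vx_w$, and let $\lambda(G)=\max_{x\in S_V}\lambda(G,x)$ be the Lagrangian of $G$. Let $[t]^{(3)}$ denote the complete $3$-graph on the vertex set $\{1,\dots,t\}$; a clique of order $t$ in $G$ is a set of $t$ vertices of $G$ all of whose $3$-element subsets are edges of $G$. Let $l$ and $m$ be integers with $6\le l\le 13$ and $\binom{l-1}{3}\le m\le\binom{l-1}{3}+\binom{l-2}{2}$. If $G$ is a $3$-graph with exactly $m$ edges that contains no clique of order $l-1$, then $$\lambda(G)<\lambda([l-1]^{(3)}).$$ -/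

import Mathlib

/-- An `r`-uniform graph with vertex set `V`: a set of `r`-element subsets of `V`. -/
structure UniformGraph (V : Type*) (r : ℕ) where
  /-- The edge set. -/
  edges : Finset (Finset V)
  /-- Every edge has exactly `r` vertices. -/
  card_edge : ∀ e ∈ edges, e.card = r

namespace UniformGraph

variable {V : Type*} {r : ℕ}

/-- The complete `r`-graph on the vertex set `V`. -/
def complete (V : Type*) [Fintype V] (r : ℕ) : UniformGraph V r where
  edges := Finset.powersetCard r Finset.univ
  card_edge := fun _ he => (Finset.mem_powersetCard.mp he).2

/-- `G` contains a clique of order `t`: some `t` vertices all of whose `r`-subsets are edges. -/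
def ContainsClique (G : UniformGraph V r) (t : ℕ) : Prop :=
  ∃ S : Finset V, S.card = t ∧ ∀ e : Finset V, e ⊆ S → e.card = r → e ∈ G.edges

/-- The value `λ(G, x) = ∑_{e ∈ E(G)} ∏_{i ∈ e} x i`. -/
def lagrangianAt (G : UniformGraph V r) (x : V → ℝ) : ℝ :=
  ∑ e ∈ G.edges, ∏ i ∈ e, x i

/-- The Lagrangian `λ(G)`, the maximum of `λ(G, x)` over the standard simplex
(nonnegative weightings of total weight one). -/
noncomputable def lagrangian [Fintype V] (G : UniformGraph V r) : ℝ :=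
  sSup (G.lagrangianAt '' stdSimplex ℝ V)

/-- The supremum defining the Lagrangian is a maximum as soon as there is a vertex. -/
theorem isGreatest_lagrangian [Fintype V] [Nonempty V] (G : UniformGraph V r) :
    IsGreatest (G.lagrangianAt '' stdSimplex ℝ V) G.lagrangian := by
  classical
  have hc : Continuous G.lagrangianAt := by
    unfold lagrangianAt
    fun_prop
  have hne : (stdSimplex ℝ V).Nonempty :=
    ⟨_, single_mem_stdSimplex ℝ (Classical.arbitrary V)⟩
  exact ((isCompact_stdSimplex ℝ V).image hc).isGreatest_sSup (hne.image _)

end UniformGraph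

/-!
Among all pairs of a `3`-graph on `V` with at most `(t choose 3) + (t - 1 choose 2)` edges and a
weighting of `V`, choose one of maximal value. Sorting the vertices by weight and exchanging edges
for edges of no smaller product, one may assume that the weights are antitone and that the `3`-graph
is left-compressed. Let `k` be the number of vertices of positive weight.

* If `k ≤ t`, then Maclaurin's inequality bounds the value by that of the complete `3`-graph on `t`
  vertices, with equality only if `k = t` and the weights are uniform.
* If `k ≥ t + 2`, then replacing the edges at the last vertex by missing triples shows that all but
  the first `t - 3` weights are at most `2 / (k - 1)` times the largest one, and so skewed a
  weighting has too small a value.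
* If `k = t + 1`, then the first-order conditions and a count of the missing triples show that no
  edge contains both of the last two vertices. These can therefore be merged without loss, so that
  the weights are those of the uniform weighting on `t` vertices with one vertex split in two.

So an optimal value that reaches that of the complete `3`-graph on `t` vertices is equal to it, and
then the exchange property of optimal pairs forces a clique of order `t`. A `3`-graph whose
Lagrangian reaches this value is itself part of an optimal pair, and hence contains a clique.
-/

namespace HypergraphLagrangian

open Finset

/-! ### Weights and links of set families -/

section Weight

variable {α : Type*} {E F : Finset (Finset α)} {s t : Finset α} {x y : α → ℝ} {c : ℝ}

/-- The Lagrange polynomial `∑_{e ∈ E} ∏_{i ∈ e} x i` of a family of finite sets. It is used for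
hypergraphs, for their links, and, with `E = powersetCard k s`, for elementary symmetric sums. -/
def weight (E : Finset (Finset α)) (x : α → ℝ) : ℝ := ∑ e ∈ E, ∏ i ∈ e, x i

theorem weight_one (E : Finset (Finset α)) : weight E (fun _ ↦ 1) = #E := by
  simp [weight]

theorem weight_mono (hx : ∀ i, 0 ≤ x i) (h : E ⊆ F) : weight E x ≤ weight F x :=
  sum_le_sum_of_subset_of_nonneg h fun _ _ _ ↦ prod_nonneg fun i _ ↦ hx i

theorem weight_congr (h : ∀ e ∈ E, ∀ i ∈ e, x i = y i) : weight E x = weight E y :=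
  sum_congr rfl fun e he ↦ prod_congr rfl (h e he)

theorem card_mul_le_weight (h : ∀ e ∈ E, c ≤ ∏ i ∈ e, x i) : #E * c ≤ weight E x := by
  simpa only [weight, nsmul_eq_mul] using card_nsmul_le_sum E _ c h

theorem weight_powersetCard_one (s : Finset α) (x : α → ℝ) :
    weight (powersetCard 1 s) x = ∑ i ∈ s, x i := by
  simp [weight, powersetCard_one]

variable [DecidableEq α]

theorem weight_sdiff_add (x : α → ℝ) (h : F ⊆ E) : weight (E \ F) x + weight F x = weight E x :=
  sum_sdiff h

theorem weight_union (x : α → ℝ) (h : Disjoint E F) :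
    weight (E ∪ F) x = weight E x + weight F x :=
  sum_union h

theorem sum_powersetCard_insert {M : Type*} [AddCommMonoid M] {a : α} (ha : a ∉ s) (k : ℕ)
    (g : Finset α → M) :
    ∑ e ∈ powersetCard (k + 1) (insert a s), g e =
      ∑ e ∈ powersetCard (k + 1) s, g e + ∑ p ∈ powersetCard k s, g (insert a p) := by
  have notMem {p : Finset α} {l : ℕ} (hp : p ∈ powersetCard l s) : a ∉ p := fun h ↦
    ha ((mem_powersetCard.1 hp).1 h)
  rw [powersetCard_succ_insert ha, sum_union, sum_image]
  · intro p hp q hq h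
    rw [← erase_insert (notMem hp), ← erase_insert (notMem hq), h]
  · rw [disjoint_left]
    intro e he he'
    obtain ⟨p, -, rfl⟩ := mem_image.1 he'
    exact notMem he (mem_insert_self a p)

theorem weight_powersetCard_insert {a : α} (ha : a ∉ s) (x : α → ℝ) (k : ℕ) :
    weight (powersetCard (k + 1) (insert a s)) x =
      weight (powersetCard (k + 1) s) x + x a * weight (powersetCard k s) x := by
  simp only [weight, sum_powersetCard_insert ha, mul_sum]
  congr 1
  exact sum_congr rfl fun p hp ↦ prod_insert fun h ↦ ha ((mem_powersetCard.1 hp).1 h)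

/-- The `k`-subsets `p` of `s` for which `t ∪ p` is an edge: the link of `t`, restricted to `s`. -/
def link (E : Finset (Finset α)) (s t : Finset α) (k : ℕ) : Finset (Finset α) :=
  {p ∈ powersetCard k s | t ∪ p ∈ E}

/-- The `k`-subsets `p` of `s` for which `t ∪ p` is not an edge. -/
def colink (E : Finset (Finset α)) (s t : Finset α) (k : ℕ) : Finset (Finset α) :=
  {p ∈ powersetCard k s | t ∪ p ∉ E}

theorem link_subset (E : Finset (Finset α)) (s t : Finset α) (k : ℕ) :
    link E s t k ⊆ powersetCard k s :=
  filter_subset _ _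

theorem colink_subset (E : Finset (Finset α)) (s t : Finset α) (k : ℕ) :
    colink E s t k ⊆ powersetCard k s :=
  filter_subset _ _

theorem weight_link_add_weight_colink (E : Finset (Finset α)) (s t : Finset α) (k : ℕ)
    (x : α → ℝ) :
    weight (link E s t k) x + weight (colink E s t k) x = weight (powersetCard k s) x :=
  sum_filter_add_sum_filter_not _ _ _

theorem weight_link_insert {a : α} (ha : a ∉ s) (E : Finset (Finset α)) (t : Finset α) (k : ℕ)
    (x : α → ℝ) :
    weight (link E (insert a s) t (k + 1)) x =
      weight (link E s t (k + 1)) x + x a * weight (link E s (insert a t) k) x := by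
  simp only [weight, link, sum_filter, sum_powersetCard_insert ha, mul_sum]
  congr 1
  refine sum_congr rfl fun p hp ↦ ?_
  rw [prod_insert fun h ↦ ha ((mem_powersetCard.1 hp).1 h), union_insert, insert_union, mul_ite,
    mul_zero]

theorem weight_colink_insert {a : α} (ha : a ∉ s) (E : Finset (Finset α)) (t : Finset α) (k : ℕ)
    (x : α → ℝ) :
    weight (colink E (insert a s) t (k + 1)) x =
      weight (colink E s t (k + 1)) x + x a * weight (colink E s (insert a t) k) x := by
  have h₁ := weight_link_add_weight_colink E (insert a s) t (k + 1) x
  have h₂ := weight_link_add_weight_colink E s t (k + 1) x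
  have h₃ := weight_link_add_weight_colink E s (insert a t) k x
  rw [weight_link_insert ha, weight_powersetCard_insert ha] at h₁
  linear_combination h₁ - h₂ - x a * h₃

theorem link_empty_eq {k : ℕ} (hE : E ⊆ powersetCard k s) : link E s ∅ k = E := by
  simp only [link, empty_union, filter_mem_eq_inter, inter_eq_right.2 hE]

theorem link_eq_powersetCard {k : ℕ} (h : ∀ p ∈ powersetCard k s, t ∪ p ∈ E) :
    link E s t k = powersetCard k s :=
  filter_true_of_mem h

theorem colink_eq_empty {k : ℕ} (h : ∀ p ∈ powersetCard k s, t ∪ p ∈ E) : colink E s t k = ∅ :=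
  filter_false_of_mem fun p hp ↦ not_not.2 (h p hp)

theorem colink_eq_empty_of_powersetCard_subset {K : Finset α} {k : ℕ}
    (hK : powersetCard (#t + k) K ⊆ E) (ht : t ⊆ K) (hs : s ⊆ K) (hst : Disjoint t s) :
    colink E s t k = ∅ :=
  colink_eq_empty fun p hp ↦ by
    obtain ⟨hps, hcard⟩ := mem_powersetCard.1 hp
    refine hK (mem_powersetCard.2 ⟨union_subset ht (hps.trans hs), ?_⟩)
    rw [card_union_of_disjoint (hst.mono_right hps), hcard]

theorem weight_split_vertex {k : ℕ} (hE : E ⊆ powersetCard (k + 1) s) {i : α} (hi : i ∈ s)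
    (x : α → ℝ) :
    weight E x = weight (link E (s.erase i) ∅ (k + 1)) x +
      x i * weight (link E (s.erase i) {i} k) x := by
  conv_lhs => rw [← link_empty_eq hE, ← insert_erase hi]
  rw [weight_link_insert (notMem_erase i s), insert_empty_eq]

theorem insert_insert_erase_erase {i j : α} (hi : i ∈ s) (hj : j ∈ s) (hij : i ≠ j) :
    insert j (insert i ((s.erase i).erase j)) = s := by
  rw [insert_comm, insert_erase (mem_erase.2 ⟨hij.symm, hj⟩), insert_erase hi]

theorem weight_split_pair {k : ℕ} (hE : E ⊆ powersetCard (k + 2) s) {i j : α} (hi : i ∈ s)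
    (hj : j ∈ s) (hij : i ≠ j) (x : α → ℝ) :
    weight E x = weight (link E ((s.erase i).erase j) ∅ (k + 2)) x +
      x i * weight (link E ((s.erase i).erase j) {i} (k + 1)) x +
      x j * weight (link E ((s.erase i).erase j) {j} (k + 1)) x +
      x i * x j * weight (link E ((s.erase i).erase j) {i, j} k) x := by
  conv_lhs => rw [← link_empty_eq hE, ← insert_insert_erase_erase hi hj hij]
  rw [weight_link_insert (by simp [hij.symm]), weight_link_insert (by simp),
    weight_link_insert (by simp)]
  simp only [insert_empty_eq]
  ring

theorem mul_weight_link_singleton {k : ℕ} (hE : E ⊆ powersetCard (k + 1) s) {i : α} (hi : i ∈ s)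
    (x : α → ℝ) :
    x i * weight (link E (s.erase i) {i} k) x = ∑ e ∈ E with i ∈ e, ∏ l ∈ e, x l := by
  have edges_avoiding : link E (s.erase i) ∅ (k + 1) = {e ∈ E | i ∉ e} := by
    ext e
    simp only [link, mem_filter, mem_powersetCard, empty_union, subset_erase]
    exact ⟨fun h ↦ ⟨h.2, h.1.1.2⟩, fun h ↦
      have he := mem_powersetCard.1 (hE h.1)
      ⟨⟨⟨he.1, h.2⟩, he.2⟩, h.1⟩⟩
  have split := sum_filter_add_sum_filter_not E (i ∈ ·) fun e ↦ ∏ l ∈ e, x l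
  have split' := weight_split_vertex hE hi x
  simp only [edges_avoiding, weight] at split split' ⊢
  linarith

/-- Euler's identity for homogeneous polynomials. -/
theorem sum_mul_weight_link_singleton {k : ℕ} (hE : E ⊆ powersetCard (k + 1) s) (x : α → ℝ) :
    ∑ i ∈ s, x i * weight (link E (s.erase i) {i} k) x = (k + 1) * weight E x := by
  rw [sum_congr rfl fun i hi ↦ mul_weight_link_singleton hE hi x]
  simp only [sum_filter]
  rw [sum_comm, weight, mul_sum]
  refine sum_congr rfl fun e he ↦ ?_
  obtain ⟨hes, hcard⟩ := mem_powersetCard.1 (hE he)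
  rw [← sum_filter, filter_mem_eq_inter, inter_eq_right.2 hes, sum_const, hcard, nsmul_eq_mul]
  push_cast
  rfl

/-- Exchanging `t` for `t'` gains at least `c` for every set linked to `t` and not to `t'`. -/
theorem card_link_sub_mul_le (E : Finset (Finset α)) (s : Finset α) {t t' : Finset α} (k : ℕ)
    (hlink : ∀ p ∈ powersetCard k s, t' ∪ p ∈ E → t ∪ p ∈ E)
    (hc : ∀ p ∈ powersetCard k s, t' ∪ p ∉ E → c ≤ ∏ i ∈ p, x i) :
    ((#(link E s t k) : ℝ) - #(link E s t' k)) * c ≤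
      weight (link E s t k) x - weight (link E s t' k) x := by
  have hsub : link E s t' k ⊆ link E s t k := fun p hp ↦ by
    obtain ⟨hp, h⟩ := mem_filter.1 hp
    exact mem_filter.2 ⟨hp, hlink p hp h⟩
  have hdiff : #(link E s t k \ link E s t' k) * c ≤ weight (link E s t k \ link E s t' k) x :=
    card_mul_le_weight fun p hp ↦ by
      obtain ⟨hp, hp'⟩ := mem_sdiff.1 hp
      have hps := link_subset E s t k hp
      exact hc p hps fun h ↦ hp' (mem_filter.2 ⟨hps, h⟩)
  rw [← weight_sdiff_add x hsub, ← Nat.cast_sub (card_le_card hsub), ← card_sdiff_of_subset hsub]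
  linarith

end Weight

section Newton

variable {α : Type*}

theorem two_mul_weight_powersetCard_two (s : Finset α) (x : α → ℝ) :
    2 * weight (powersetCard 2 s) x = (∑ i ∈ s, x i) ^ 2 - ∑ i ∈ s, x i ^ 2 := by
  classical
  induction s using Finset.induction_on with
  | empty =>
    rw [powersetCard_eq_empty.2 (by simp)]
    simp [weight]
  | insert a s ha ih =>
    rw [weight_powersetCard_insert ha, weight_powersetCard_one, sum_insert ha, sum_insert ha]
    linear_combination ih

theorem six_mul_weight_powersetCard_three (s : Finset α) (x : α → ℝ) :
    6 * weight (powersetCard 3 s) x =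
      (∑ i ∈ s, x i) ^ 3 - 3 * (∑ i ∈ s, x i) * ∑ i ∈ s, x i ^ 2 + 2 * ∑ i ∈ s, x i ^ 3 := by
  classical
  induction s using Finset.induction_on with
  | empty =>
    rw [powersetCard_eq_empty.2 (by simp)]
    simp [weight]
  | insert a s ha ih =>
    rw [weight_powersetCard_insert ha, sum_insert ha, sum_insert ha, sum_insert ha]
    linear_combination ih + 3 * x a * two_mul_weight_powersetCard_two s x

end Newton

/-! ### Optimal pairs -/

section Optimal

variable {α : Type*} [DecidableEq α] {U W : Finset α} {k M : ℕ} {E : Finset (Finset α)}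
  {x : α → ℝ} {i j : α} {u v : ℝ}

/-- Points of the standard simplex on `U`, extended by zero. -/
structure IsWeighting (U : Finset α) (x : α → ℝ) : Prop where
  nonneg : ∀ i, 0 ≤ x i
  eq_zero : ∀ i ∉ U, x i = 0
  sum_eq : ∑ i ∈ U, x i = 1

omit [DecidableEq α] in
theorem IsWeighting.of_eq_zero (h : IsWeighting U x) (hzero : ∀ i ∉ W, x i = 0) :
    IsWeighting W x where
  nonneg := h.nonneg
  eq_zero := hzero
  sum_eq := by
    classical
    rw [← h.sum_eq, ← sum_subset (inter_subset_left : W ∩ U ⊆ W) fun i hi hn ↦ ?_]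
    · exact sum_subset inter_subset_right fun i hi hn ↦
        hzero i fun hW ↦ hn (mem_inter.2 ⟨hW, hi⟩)
    · exact h.eq_zero i fun hU ↦ hn (mem_inter.2 ⟨hi, hU⟩)

omit [DecidableEq α] in
theorem IsWeighting.superset (h : IsWeighting W x) (hW : W ⊆ U) : IsWeighting U x :=
  h.of_eq_zero fun i hi ↦ h.eq_zero i (mt (@hW i) hi)

/-- The weighting obtained from `x` by giving weight `u` to `i` and weight `v` to `j`. -/
def move (x : α → ℝ) (i j : α) (u v : ℝ) : α → ℝ :=
  Function.update (Function.update x i u) j v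

theorem move_right (x : α → ℝ) (i j : α) (u v : ℝ) : move x i j u v j = v := by simp [move]

theorem move_left (x : α → ℝ) (hij : i ≠ j) (u v : ℝ) : move x i j u v i = u := by
  simp [move, hij]

theorem move_of_ne (x : α → ℝ) {l : α} (hi : l ≠ i) (hj : l ≠ j) (u v : ℝ) :
    move x i j u v l = x l := by
  simp [move, hi, hj]

theorem IsWeighting.move (h : IsWeighting U x) (hi : i ∈ U) (hj : j ∈ U) (hij : i ≠ j)
    (hu : 0 ≤ u) (hv : 0 ≤ v) (huv : u + v = x i + x j) : IsWeighting U (move x i j u v) where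
  nonneg l := by
    rcases eq_or_ne l j with rfl | hlj
    · rwa [move_right]
    rcases eq_or_ne l i with rfl | hli
    · rwa [move_left _ hij]
    rw [move_of_ne _ hli hlj]
    exact h.nonneg l
  eq_zero l hl := by
    rw [move_of_ne _ (by rintro rfl; exact hl hi) (by rintro rfl; exact hl hj)]
    exact h.eq_zero l hl
  sum_eq := by
    have hsum := h.sum_eq
    rw [← insert_insert_erase_erase hi hj hij, sum_insert (by simp [hij.symm]),
      sum_insert (by simp)] at hsum ⊢
    rw [move_right, move_left _ hij, ← hsum, sum_congr rfl fun l hl ↦ ?_]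
    · linarith
    · simp only [mem_erase] at hl
      exact move_of_ne _ hl.2.1 hl.1 _ _

theorem weight_move (hE : E ⊆ powersetCard (k + 2) U) (hi : i ∈ U) (hj : j ∈ U) (hij : i ≠ j)
    (x : α → ℝ) (u v : ℝ) :
    weight E (move x i j u v) = weight (link E ((U.erase i).erase j) ∅ (k + 2)) x +
      u * weight (link E ((U.erase i).erase j) {i} (k + 1)) x +
      v * weight (link E ((U.erase i).erase j) {j} (k + 1)) x +
      u * v * weight (link E ((U.erase i).erase j) {i, j} k) x := by
  have link_move (t : Finset α) (l : ℕ) :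
      weight (link E ((U.erase i).erase j) t l) (move x i j u v) =
        weight (link E ((U.erase i).erase j) t l) x := weight_congr fun p hp a ha ↦ by
    have ha := (mem_powersetCard.1 (link_subset _ _ _ _ hp)).1 ha
    simp only [mem_erase] at ha
    exact move_of_ne _ ha.2.1 ha.1 _ _
  simp only [weight_split_pair hE hi hj hij, move_right, move_left _ hij, link_move]

/-- A weighting of `U` together with a `k`-uniform hypergraph on `U` with at most `M` edges. -/
structure Feasible (k : ℕ) (U : Finset α) (M : ℕ) (E : Finset (Finset α)) (x : α → ℝ) : Prop
    extends IsWeighting U x where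
  edges : E ⊆ powersetCard k U
  card_le : #E ≤ M

/-- Pairs attaining the largest Lagrangian of a `k`-uniform hypergraph on `U` with at most `M`
edges. -/
structure IsOptimal (k : ℕ) (U : Finset α) (M : ℕ) (E : Finset (Finset α)) (x : α → ℝ) : Prop
    extends Feasible k U M E x where
  weight_le : ∀ {E' x'}, Feasible k U M E' x' → weight E' x' ≤ weight E x

omit [DecidableEq α] in
theorem IsOptimal.weight_le_of_isWeighting (h : IsOptimal k U M E x) {y : α → ℝ}
    (hy : IsWeighting U y) : weight E y ≤ weight E x :=
  h.weight_le ⟨hy, h.edges, h.card_le⟩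

theorem eq_zero_of_forall_quadratic_nonpos {p q a c : ℝ} (hp : 0 < p) (hq : 0 < q)
    (h : ∀ t, -p ≤ t → t ≤ q → t * a - t ^ 2 * c ≤ 0) : a = 0 := by
  have hmax : IsLocalMax (fun t : ℝ ↦ t * a - t ^ 2 * c) 0 := by
    filter_upwards [Icc_mem_nhds (neg_lt_zero.2 hp) hq] with t ht
    simpa using h t ht.1 ht.2
  have hderiv : HasDerivAt (fun t : ℝ ↦ t * a - t ^ 2 * c) a 0 := by
    simpa using
      ((hasDerivAt_id (0 : ℝ)).mul_const a).fun_sub ((hasDerivAt_pow 2 (0 : ℝ)).mul_const c)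
  exact hmax.hasDerivAt_eq_zero hderiv

theorem IsOptimal.weight_link_balance (h : IsOptimal (k + 2) U M E x) (hi : i ∈ U) (hj : j ∈ U)
    (hij : i ≠ j) (hxi : 0 < x i) (hxj : 0 < x j) :
    weight (link E ((U.erase i).erase j) {i} (k + 1)) x +
        x j * weight (link E ((U.erase i).erase j) {i, j} k) x =
      weight (link E ((U.erase i).erase j) {j} (k + 1)) x +
        x i * weight (link E ((U.erase i).erase j) {i, j} k) x := by
  set A := weight (link E ((U.erase i).erase j) {i} (k + 1)) x
  set B := weight (link E ((U.erase i).erase j) {j} (k + 1)) x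
  set C := weight (link E ((U.erase i).erase j) {i, j} k) x
  have stationary : A + x j * C - (B + x i * C) = 0 :=
    eq_zero_of_forall_quadratic_nonpos (c := C) hxi hxj fun t hti htj ↦ by
      have hle := h.weight_le_of_isWeighting <|
        h.toIsWeighting.move hi hj hij (u := x i + t) (v := x j - t) (by linarith) (by linarith)
          (by ring)
      rw [weight_move h.edges hi hj hij, weight_split_pair h.edges hi hj hij x] at hle
      linarith
  linarith

theorem IsOptimal.weight_link_singleton_eq (h : IsOptimal (k + 2) U M E x) (hi : i ∈ U)
    (hj : j ∈ U) (hxi : 0 < x i) (hxj : 0 < x j) :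
    weight (link E (U.erase i) {i} (k + 1)) x = weight (link E (U.erase j) {j} (k + 1)) x := by
  rcases eq_or_ne i j with rfl | hij
  · rfl
  have hUi : insert j ((U.erase i).erase j) = U.erase i :=
    insert_erase (mem_erase.2 ⟨hij.symm, hj⟩)
  have hUj : insert i ((U.erase i).erase j) = U.erase j := by
    rw [erase_right_comm]
    exact insert_erase (mem_erase.2 ⟨hij, hi⟩)
  rw [← hUi, weight_link_insert (by simp), ← hUj, weight_link_insert (by simp), pair_comm j i]
  exact h.weight_link_balance hi hj hij hxi hxj

/-- Lagrange multipliers: at an interior optimum all partial derivatives agree, and by Euler's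
identity their common value is the degree times the Lagrangian. -/
theorem IsOptimal.weight_link_singleton (h : IsOptimal (k + 2) U M E x) (hpos : ∀ i ∈ U, 0 < x i)
    (hi : i ∈ U) : weight (link E (U.erase i) {i} (k + 1)) x = (k + 2) * weight E x := by
  have euler := sum_mul_weight_link_singleton h.edges x
  rw [sum_congr rfl fun j hj ↦ by
    rw [h.weight_link_singleton_eq hj hi (hpos j hj) (hpos i hi)], ← sum_mul, h.sum_eq] at euler
  push_cast at euler
  linarith

theorem weight_exchange {e f : Finset α} (he : e ∈ E) (hf : f ∉ E) (x : α → ℝ) :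
    weight (insert f (E.erase e)) x = weight E x - ∏ i ∈ e, x i + ∏ i ∈ f, x i := by
  unfold weight
  rw [sum_insert fun h ↦ hf (mem_of_mem_erase h), ← sum_erase_add E _ he]
  ring

theorem Feasible.exchange (h : Feasible k U M E x) {e f : Finset α} (he : e ∈ E) (hf : f ∉ E)
    (hfU : f ∈ powersetCard k U) : Feasible k U M (insert f (E.erase e)) x where
  toIsWeighting := h.toIsWeighting
  edges := insert_subset hfU ((erase_subset _ _).trans h.edges)
  card_le := by
    rw [card_insert_of_notMem fun h ↦ hf (mem_of_mem_erase h), card_erase_add_one he]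
    exact h.card_le

omit [DecidableEq α] in
theorem IsOptimal.prod_le_prod (h : IsOptimal k U M E x) {e f : Finset α} (he : e ∈ E)
    (hf : f ∉ E) (hfU : f ∈ powersetCard k U) : ∏ i ∈ f, x i ≤ ∏ i ∈ e, x i := by
  classical
  have hle := h.weight_le (h.toFeasible.exchange he hf hfU)
  rw [weight_exchange he hf] at hle
  linarith

theorem weight_filter_subset (hzero : ∀ i ∉ W, x i = 0) :
    weight {e ∈ E | e ⊆ W} x = weight E x := by
  refine sum_subset (filter_subset _ _) fun e he hne ↦ ?_
  obtain ⟨i, hi, hiW⟩ := not_subset.1 fun h ↦ hne (mem_filter.2 ⟨he, h⟩)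
  exact prod_eq_zero hi (hzero i hiW)

theorem IsOptimal.restrict (h : IsOptimal k U M E x) (hW : W ⊆ U) (hzero : ∀ i ∉ W, x i = 0) :
    IsOptimal k W M {e ∈ E | e ⊆ W} x where
  toIsWeighting := h.toIsWeighting.of_eq_zero hzero
  edges e he := by
    obtain ⟨heE, heW⟩ := mem_filter.1 he
    exact mem_powersetCard.2 ⟨heW, (mem_powersetCard.1 (h.edges heE)).2⟩
  card_le := (card_filter_le _ _).trans h.card_le
  weight_le h' := by
    rw [weight_filter_subset hzero]
    exact h.weight_le ⟨h'.toIsWeighting.superset hW,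
      h'.edges.trans (powersetCard_mono hW), h'.card_le⟩

end Optimal

/-! ### Compressed families of triples -/

section Compressed

variable {E : Finset (Finset ℕ)} {x : ℕ → ℝ} {k M N r : ℕ}

theorem exists_sorted_pair {e : Finset ℕ} (h : #e = 2) : ∃ a b, a < b ∧ e = {a, b} := by
  obtain ⟨a, b, hab, rfl⟩ := card_eq_two.1 h
  rcases lt_or_gt_of_ne hab with h | h
  · exact ⟨a, b, h, rfl⟩
  · exact ⟨b, a, h, pair_comm a b⟩

theorem exists_sorted_triple {e : Finset ℕ} (h : #e = 3) :
    ∃ a b c, a < b ∧ b < c ∧ e = {a, b, c} := by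
  have hne : e.Nonempty := card_pos.1 (by omega)
  obtain ⟨b, c, hbc, he⟩ := exists_sorted_pair (e := e.erase (e.min' hne))
    (by rw [card_erase_of_mem (min'_mem _ _), h])
  refine ⟨e.min' hne, b, c, min'_lt_of_mem_erase_min' _ hne (by simp [he]), hbc, ?_⟩
  rw [← he, insert_erase (min'_mem _ _)]

theorem prod_triple (x : ℕ → ℝ) {a b c : ℕ} (hab : a < b) (hbc : b < c) :
    ∏ i ∈ ({a, b, c} : Finset ℕ), x i = x a * x b * x c := by
  rw [prod_insert (by simp; omega), prod_pair hbc.ne, mul_assoc]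

theorem mul_mul_le_mul_mul_of_antitone (hx : Antitone x) (hx₀ : ∀ i, 0 ≤ x i) {a b c a' b' c' : ℕ}
    (ha : a ≤ a') (hb : b ≤ b') (hc : c ≤ c') : x a' * x b' * x c' ≤ x a * x b * x c :=
  mul_le_mul (mul_le_mul (hx ha) (hx hb) (hx₀ _) (hx₀ _)) (hx hc) (hx₀ _)
    (mul_nonneg (hx₀ _) (hx₀ _))

theorem mul_mul_le_prod (hx : Antitone x) (hx₀ : ∀ i, 0 ≤ x i) {e : Finset ℕ}
    (he : e ∈ powersetCard 3 (range (r + 3))) : x r * x (r + 1) * x (r + 2) ≤ ∏ i ∈ e, x i := by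
  obtain ⟨hs, hcard⟩ := mem_powersetCard.1 he
  obtain ⟨a, b, c, hab, hbc, rfl⟩ := exists_sorted_triple hcard
  have hc : c < r + 3 := mem_range.1 (hs (by simp))
  rw [prod_triple x hab hbc]
  exact mul_mul_le_mul_mul_of_antitone hx hx₀ (by omega) (by omega) (by omega)

theorem mul_le_prod (hx : Antitone x) (hx₀ : ∀ i, 0 ≤ x i) {e : Finset ℕ}
    (he : e ∈ powersetCard 2 (range (r + 2))) : x r * x (r + 1) ≤ ∏ i ∈ e, x i := by
  obtain ⟨hs, hcard⟩ := mem_powersetCard.1 he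
  obtain ⟨a, b, hab, rfl⟩ := exists_sorted_pair hcard
  have hb : b < r + 2 := mem_range.1 (hs (by simp))
  rw [prod_pair hab.ne]
  exact mul_le_mul (hx (by omega)) (hx (by omega)) (hx₀ _) (hx₀ _)

/-- A family is compressed (left-shifted) when replacing a vertex of a member by a smaller
non-vertex yields a member. -/
def Compressed (E : Finset (Finset ℕ)) : Prop :=
  ∀ e ∈ E, ∀ j ∈ e, ∀ i < j, i ∉ e → insert i (e.erase j) ∈ E

theorem Compressed.mono_triple (hE : Compressed E) {a b c a' b' c' : ℕ} (hab : a < b) (hbc : b < c)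
    (hab' : a' < b') (hbc' : b' < c') (ha : a ≤ a') (hb : b ≤ b') (hc : c ≤ c')
    (h : ({a', b', c'} : Finset ℕ) ∈ E) : ({a, b, c} : Finset ℕ) ∈ E := by
  have h₁ : ({a, b', c'} : Finset ℕ) ∈ E := by
    rcases ha.eq_or_lt with rfl | ha
    · exact h
    have := hE _ h a' (by simp) a ha (by simp; omega)
    rwa [erase_insert (by simp; omega)] at this
  have h₂ : ({a, b, c'} : Finset ℕ) ∈ E := by
    rcases hb.eq_or_lt with rfl | hb
    · exact h₁
    convert hE _ h₁ b' (by simp) b hb (by simp; omega) using 1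
    ext i
    simp only [mem_insert, mem_singleton, mem_erase]
    omega
  rcases hc.eq_or_lt with rfl | hc
  · exact h₂
  convert hE _ h₂ c' (by simp) c hc (by simp; omega) using 1
  ext i
  simp only [mem_insert, mem_singleton, mem_erase]
  omega

theorem Compressed.filter_range (hE : Compressed E) (k : ℕ) :
    Compressed {e ∈ E | e ⊆ range k} := by
  intro e he j hj i hij hi
  obtain ⟨he, hek⟩ := mem_filter.1 he
  refine mem_filter.2 ⟨hE e he j hj i hij hi, insert_subset ?_ ((erase_subset _ _).trans hek)⟩
  exact mem_range.2 (hij.trans (mem_range.1 (hek hj)))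

theorem IsOptimal.exists_compressed (h : IsOptimal k (range N) M E x) (hx : Antitone x) :
    ∃ E', IsOptimal k (range N) M E' x ∧ Compressed E' ∧ weight E' x = weight E x := by
  induction hw : ∑ e ∈ E, ∑ i ∈ e, i using Nat.strong_induction_on generalizing E with
  | _ w ih =>
    by_cases hcomp : Compressed E
    · exact ⟨E, h, hcomp, rfl⟩
    simp only [Compressed, not_forall] at hcomp
    obtain ⟨e, he, j, hj, i, hij, hi, hf⟩ := hcomp
    set f := insert i (e.erase j) with hfdef
    obtain ⟨heN, hecard⟩ := mem_powersetCard.1 (h.edges he)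
    have hi' : i ∉ e.erase j := fun h ↦ hi (mem_of_mem_erase h)
    have hfN : f ∈ powersetCard k (range N) := by
      refine mem_powersetCard.2 ⟨insert_subset ?_ ((erase_subset _ _).trans heN), ?_⟩
      · exact mem_range.2 (hij.trans (mem_range.1 (heN hj)))
      · rw [card_insert_of_notMem hi', card_erase_add_one hj, hecard]
    have hprod : ∏ l ∈ e, x l ≤ ∏ l ∈ f, x l := by
      rw [hfdef, prod_insert hi', ← mul_prod_erase e x hj]
      exact mul_le_mul_of_nonneg_right (hx hij.le) (prod_nonneg fun l _ ↦ h.nonneg l)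
    have hfeas := h.toFeasible.exchange he hf hfN
    have heq : weight (insert f (E.erase e)) x = weight E x :=
      le_antisymm (h.weight_le hfeas) (by linarith [weight_exchange he hf x])
    have hdecr : ∑ e ∈ insert f (E.erase e), ∑ i ∈ e, i < w := by
      rw [← hw, sum_insert fun h ↦ hf (mem_of_mem_erase h), ← sum_erase_add E _ he, hfdef,
        sum_insert hi', ← sum_erase_add e _ hj]
      omega
    obtain ⟨E', hopt', hcomp', hweight'⟩ := ih _ hdecr ⟨hfeas, fun h' ↦ heq ▸ h.weight_le h'⟩ rfl
    exact ⟨E', hopt', hcomp', hweight'.trans heq⟩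

/-- The triples of `range (r + 4)` that do not contain both `r + 2` and `r + 3`: the clique of
order `r + 3` with its last vertex doubled. It has the largest number of edges allowed in the
theorem. -/
def twinGraph (r : ℕ) : Finset (Finset ℕ) :=
  {e ∈ powersetCard 3 (range (r + 4)) | ¬ (r + 2 ∈ e ∧ r + 3 ∈ e)}

theorem card_twinGraph (r : ℕ) : #(twinGraph r) = (r + 3).choose 3 + (r + 2).choose 2 := by
  have avoiding_last : ∀ e ∈ powersetCard 3 (range (r + 3)), ¬ (r + 2 ∈ e ∧ r + 3 ∈ e) :=
    fun e he h ↦ by simpa using (mem_powersetCard.1 he).1 h.2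
  have through_last :
      {p ∈ powersetCard 2 (range (r + 3)) |
        ¬ (r + 2 ∈ insert (r + 3) p ∧ r + 3 ∈ insert (r + 3) p)} =
      powersetCard 2 (range (r + 2)) := by
    ext p
    rw [range_add_one (n := r + 2)]
    simp only [mem_filter, mem_powersetCard, mem_insert, subset_insert_iff]
    grind
  rw [twinGraph, card_filter, range_add_one, sum_powersetCard_insert (by simp), ← card_filter,
    ← card_filter, filter_true_of_mem avoiding_last, through_last, card_powersetCard,
    card_powersetCard, card_range, card_range]

theorem mul_mul_le_prod_of_mem_twinGraph (hx : Antitone x) (hx₀ : ∀ i, 0 ≤ x i) {e : Finset ℕ}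
    (he : e ∈ twinGraph r) : x r * x (r + 1) * x (r + 3) ≤ ∏ i ∈ e, x i := by
  obtain ⟨he, hne⟩ := mem_filter.1 he
  obtain ⟨hs, hcard⟩ := mem_powersetCard.1 he
  obtain ⟨a, b, c, hab, hbc, rfl⟩ := exists_sorted_triple hcard
  have hc : c < r + 4 := mem_range.1 (hs (by simp))
  have hb : b ≤ r + 1 := by
    by_contra hb
    exact hne ⟨by simp; omega, by simp; omega⟩
  rw [prod_triple x hab hbc]
  exact mul_mul_le_mul_mul_of_antitone hx hx₀ (by omega) hb (by omega)

end Compressed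

section Merge

variable {α : Type*} [DecidableEq α] {U : Finset α} {k M : ℕ} {E : Finset (Finset α)}
  {x : α → ℝ} {i j : α}

/-- The weighting obtained from `x` by moving all the weight of `j` to `i`. -/
def merge (x : α → ℝ) (i j : α) : α → ℝ := move x i j (x i + x j) 0

theorem merge_right (x : α → ℝ) (i j : α) : merge x i j j = 0 := move_right ..

theorem merge_left (x : α → ℝ) (hij : i ≠ j) : merge x i j i = x i + x j := move_left x hij ..

theorem merge_of_ne (x : α → ℝ) {l : α} (hi : l ≠ i) (hj : l ≠ j) : merge x i j l = x l :=
  move_of_ne x hi hj ..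

theorem le_merge (hx : ∀ i, 0 ≤ x i) (hij : i ≠ j) {l : α} (hl : l ≠ j) : x l ≤ merge x i j l := by
  rcases eq_or_ne l i with rfl | hli
  · rw [merge_left x hij]
    exact le_add_of_nonneg_right (hx j)
  · rw [merge_of_ne x hli hl]

theorem IsWeighting.merge (h : IsWeighting U x) (hi : i ∈ U) (hj : j ∈ U) (hij : i ≠ j) :
    IsWeighting U (merge x i j) :=
  h.move hi hj hij (add_nonneg (h.nonneg _) (h.nonneg _)) le_rfl (add_zero _)

theorem IsOptimal.weight_merge (h : IsOptimal (k + 2) U M E x) (hi : i ∈ U) (hj : j ∈ U)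
    (hij : i ≠ j) (hxi : 0 < x i) (hxj : 0 < x j) :
    weight E (merge x i j) =
      weight E x - x j ^ 2 * weight (link E ((U.erase i).erase j) {i, j} k) x := by
  rw [merge, weight_move h.edges hi hj hij, weight_split_pair h.edges hi hj hij x]
  linear_combination x j * h.weight_link_balance hi hj hij hxi hxj

omit [DecidableEq α] in
theorem IsOptimal.exists_mem_edge (h : IsOptimal (k + 2) U M E x) (hpos : ∀ i ∈ U, 0 < x i)
    (hweight : 0 < weight E x) (hi : i ∈ U) : ∃ e ∈ E, i ∈ e := by
  classical
  by_contra! hne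
  have hderiv := mul_weight_link_singleton h.edges hi x
  rw [h.weight_link_singleton hpos hi, filter_false_of_mem hne, sum_empty] at hderiv
  have hxi := hpos i hi
  exact absurd hderiv (by positivity)

theorem IsOptimal.six_mul_weight_le (h : IsOptimal 3 U M E x) (hpos : ∀ i ∈ U, 0 < x i)
    (hi : i ∈ U) : 6 * weight E x ≤ (1 - x i) ^ 2 - ∑ l ∈ U.erase i, x l ^ 2 := by
  have hderiv := h.weight_link_singleton hpos hi
  have hle := weight_mono h.nonneg (link_subset E (U.erase i) {i} 2)
  have hsum : ∑ l ∈ U.erase i, x l = 1 - x i := by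
    rw [← h.sum_eq, ← sum_erase_add _ _ hi, add_sub_cancel_right]
  have hnewton := two_mul_weight_powersetCard_two (U.erase i) x
  rw [hsum] at hnewton
  push_cast at hderiv
  linarith

end Merge

section Coneighbors

variable {E : Finset (Finset ℕ)} {x : ℕ → ℝ} {j k M N r : ℕ}

/-- The vertices below `j` that form an edge with `j` and `j + 1`; it is used when these are the
last two vertices. -/
def coneighbors (E : Finset (Finset ℕ)) (j : ℕ) : Finset ℕ := {i ∈ range j | {i, j, j + 1} ∈ E}

theorem mem_coneighbors {i : ℕ} : i ∈ coneighbors E j ↔ i < j ∧ {i, j, j + 1} ∈ E := by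
  simp [coneighbors]

theorem Compressed.insert_mem (hE : Compressed E) {i : ℕ} (hi : i ∈ coneighbors E j)
    {p : Finset ℕ} (hp : p ∈ powersetCard 2 ((range (j + 2)).erase i)) : insert i p ∈ E := by
  obtain ⟨hij, hi⟩ := mem_coneighbors.1 hi
  obtain ⟨hs, hcard⟩ := mem_powersetCard.1 hp
  obtain ⟨c, d, hcd, rfl⟩ := exists_sorted_pair hcard
  have hc := hs (show c ∈ ({c, d} : Finset ℕ) by simp)
  have hd := hs (show d ∈ ({c, d} : Finset ℕ) by simp)
  simp only [mem_erase, mem_range] at hc hd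
  rcases lt_or_gt_of_ne hc.1 with hci | hic
  · rw [insert_comm]
    rcases lt_or_gt_of_ne hd.1 with hdi | hid
    · rw [pair_comm i d]
      exact hE.mono_triple hcd hdi hij (by omega) (by omega) (by omega) (by omega) hi
    · exact hE.mono_triple hci hid hij (by omega) (by omega) (by omega) (by omega) hi
  · exact hE.mono_triple hic hcd hij (by omega) le_rfl (by omega) (by omega) hi

theorem Compressed.zero_mem_coneighbors (hE : Compressed E) (h : (coneighbors E j).Nonempty) :
    0 ∈ coneighbors E j := by
  obtain ⟨i, hi⟩ := h
  obtain ⟨hij, hi⟩ := mem_coneighbors.1 hi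
  have hj : 0 < j := i.zero_le.trans_lt hij
  exact mem_coneighbors.2
    ⟨hj, hE.mono_triple hj (by omega) hij (by omega) i.zero_le le_rfl le_rfl hi⟩

theorem erase_erase_range (j : ℕ) : ((range (j + 2)).erase j).erase (j + 1) = range j := by
  ext i
  simp only [mem_erase, mem_range]
  omega

theorem weight_link_one {α : Type*} [DecidableEq α] (E : Finset (Finset α)) (s t : Finset α)
    (x : α → ℝ) : weight (link E s t 1) x = ∑ i ∈ s with insert i t ∈ E, x i := by
  simp [weight, link, sum_filter, powersetCard_one, union_singleton]

theorem card_le_card_edges_through {α : Type*} [DecidableEq α] {E : Finset (Finset α)} {v w : α}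
    {s : Finset α} (h : ∀ i ∈ s, i ≠ v ∧ i ≠ w ∧ {i, v, w} ∈ E) :
    #s ≤ #{e ∈ {e ∈ E | w ∈ e} | v ∈ e} := by
  refine card_le_card_of_injOn (fun i ↦ {i, v, w})
    (fun i hi ↦ by simpa using (h i hi).2.2) fun a ha b _ hab ↦ ?_
  have hmem : a ∈ ({b, v, w} : Finset α) := by
    rw [← show ({a, v, w} : Finset α) = {b, v, w} from hab]
    exact mem_insert_self ..
  simpa [(h a ha).1, (h a ha).2.1] using hmem

theorem Compressed.le_card_edges_through (hE : Compressed E) {v : ℕ} (hv : v ∈ coneighbors E j) :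
    j ≤ #{e ∈ {e ∈ E | j + 1 ∈ e} | v ∈ e} := by
  have hvj := (mem_coneighbors.1 hv).1
  have hcard : #((range (j + 1)).erase v) = j := by
    rw [card_erase_of_mem (mem_range.2 (by omega)), card_range, Nat.add_sub_cancel]
  refine hcard.symm.trans_le (card_le_card_edges_through fun i hi ↦ ?_)
  simp only [mem_erase, mem_range] at hi
  refine ⟨hi.1, by omega, ?_⟩
  rw [insert_comm]
  refine hE.insert_mem hv (mem_powersetCard.2 ⟨?_, card_pair (by omega)⟩)
  simp only [insert_subset_iff, singleton_subset_iff, mem_erase, mem_range]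
  omega

/-- Double counting in the link of `j + 1`: there `j` has degree `#(coneighbors E j)`, and each
coneighbor is joined to all other vertices. -/
theorem Compressed.card_coneighbors_mul_le (hE : Compressed E) (hE₃ : ∀ e ∈ E, #e = 3) (j : ℕ) :
    #(coneighbors E j) * (j + 1) ≤ 2 * #{e ∈ E | j + 1 ∈ e} := by
  set B := coneighbors E j
  set D := {e ∈ E | j + 1 ∈ e}
  have codegree_self : #B ≤ #{e ∈ D | j ∈ e} := card_le_card_edges_through fun i hi ↦ by
    obtain ⟨hij, hi⟩ := mem_coneighbors.1 hi
    exact ⟨by omega, by omega, hi⟩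
  have hjB : j ∉ B := fun h ↦ lt_irrefl j (mem_coneighbors.1 h).1
  have hB : insert j B ⊆ range (j + 1) := insert_subset (by simp) fun i hi ↦
    mem_range.2 ((mem_coneighbors.1 hi).1.trans j.lt_succ_self)
  have card_trace : ∀ e ∈ D, #{v ∈ range (j + 1) | v ∈ e} ≤ 2 := fun e he ↦ by
    obtain ⟨heE, hje⟩ := mem_filter.1 he
    calc #{v ∈ range (j + 1) | v ∈ e} ≤ #(e.erase (j + 1)) := card_le_card fun _ hv ↦ by
          simp only [mem_filter, mem_range] at hv
          exact mem_erase.2 ⟨hv.1.ne, hv.2⟩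
      _ = 2 := by rw [card_erase_of_mem hje, hE₃ e heE]
  calc #B * (j + 1) = #B + ∑ _ ∈ B, j := by rw [sum_const, smul_eq_mul]; ring
    _ ≤ #{e ∈ D | j ∈ e} + ∑ v ∈ B, #{e ∈ D | v ∈ e} :=
      add_le_add codegree_self (sum_le_sum fun _ ↦ hE.le_card_edges_through)
    _ = ∑ v ∈ insert j B, #{e ∈ D | v ∈ e} := by rw [sum_insert hjB]
    _ ≤ ∑ v ∈ range (j + 1), #{e ∈ D | v ∈ e} := sum_le_sum_of_subset hB
    _ = ∑ e ∈ D, #{v ∈ range (j + 1) | v ∈ e} :=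
      sum_card_bipartiteAbove_eq_sum_card_bipartiteBelow (· ∈ ·)
    _ ≤ #D * 2 := by simpa using sum_le_card_nsmul D _ 2 card_trace
    _ = 2 * #D := mul_comm ..

/-- An optimal pair of triple systems in normal form: the weights are decreasing, positive exactly
on `range k`, and the edges are compressed. -/
structure IsShiftedOptimum (k M : ℕ) (E : Finset (Finset ℕ)) (x : ℕ → ℝ) : Prop
    extends IsOptimal 3 (range k) M E x where
  pos : ∀ i < k, 0 < x i
  antitone : Antitone x
  compressed : Compressed E

theorem IsShiftedOptimum.pos_of_mem (h : IsShiftedOptimum k M E x) : ∀ i ∈ range k, 0 < x i :=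
  fun i hi ↦ h.pos i (mem_range.1 hi)

theorem IsShiftedOptimum.card_edge (h : IsShiftedOptimum k M E x) : ∀ e ∈ E, #e = 3 :=
  fun _ he ↦ (mem_powersetCard.1 (h.edges he)).2

theorem weight_link_last (E : Finset (Finset ℕ)) (x : ℕ → ℝ) (j : ℕ) :
    weight (link E (range j) {j, j + 1} 1) x = ∑ i ∈ coneighbors E j, x i :=
  weight_link_one ..

theorem IsShiftedOptimum.weight_merge_last (h : IsShiftedOptimum (j + 2) M E x) :
    weight E (merge x j (j + 1)) =
      weight E x - x (j + 1) ^ 2 * ∑ i ∈ coneighbors E j, x i := by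
  rw [h.weight_merge (by simp) (by simp) (by simp) (h.pos _ (by omega)) (h.pos _ (by omega)),
    erase_erase_range, weight_link_last]

theorem weight_filter_notMem {α : Type*} [DecidableEq α] {E : Finset (Finset α)} {x : α → ℝ}
    {i : α} (hx : x i = 0) : weight {e ∈ E | i ∉ e} x = weight E x := by
  refine sum_subset (filter_subset _ _) fun e he hne ↦ ?_
  have hi : i ∈ e := by
    by_contra hi
    exact hne (mem_filter.2 ⟨he, hi⟩)
  exact prod_eq_zero hi hx

/-- After the last two vertices are merged, the edges at the last one are worthless and can be
replaced by any missing triples; the gain is at most the loss caused by merging. -/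
theorem IsShiftedOptimum.weight_le_of_card_le {R : Finset (Finset ℕ)}
    (h : IsShiftedOptimum (j + 2) M E x) (hR : R ⊆ powersetCard 3 (range (j + 1)) \ E)
    (hcard : #R ≤ #{e ∈ E | j + 1 ∈ e}) :
    weight R (merge x j (j + 1)) ≤ x (j + 1) ^ 2 * ∑ i ∈ coneighbors E j, x i := by
  have hdisj : Disjoint {e ∈ E | j + 1 ∉ e} R := disjoint_left.2 fun e he heR ↦
    (mem_sdiff.1 (hR heR)).2 (mem_filter.1 he).1
  have hfeas : Feasible 3 (range (j + 2)) M ({e ∈ E | j + 1 ∉ e} ∪ R) (merge x j (j + 1)) := by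
    refine ⟨h.toIsWeighting.merge (by simp) (by simp) (by simp),
      union_subset ((filter_subset _ _).trans h.edges) fun e he ↦
        powersetCard_mono (range_subset_range.2 (by omega)) (mem_sdiff.1 (hR he)).1, ?_⟩
    have := card_filter_add_card_filter_not (s := E) (j + 1 ∈ ·)
    rw [card_union_of_disjoint hdisj]
    exact le_trans (by omega) h.card_le
  have hle := h.weight_le hfeas
  rw [weight_union _ hdisj, weight_filter_notMem (merge_right ..), h.weight_merge_last] at hle
  linarith

theorem IsShiftedOptimum.degree_last_mul_le (hj : r + 3 ≤ j)
    (h : IsShiftedOptimum (j + 2) #(twinGraph r) E x) :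
    #{e ∈ E | j + 1 ∈ e} * (x r * x (r + 1) * x (r + 3)) ≤
      x (j + 1) ^ 2 * ∑ i ∈ coneighbors E j, x i := by
  have twinGraph_subset {e : Finset ℕ} (he : e ∈ twinGraph r) :
      e ∈ powersetCard 3 (range (j + 1)) :=
    powersetCard_mono (range_subset_range.2 (by omega)) (mem_filter.1 he).1
  have hmissing : #{e ∈ E | j + 1 ∈ e} ≤ #(twinGraph r \ E) := by
    refine (card_le_card fun e he ↦ ?_).trans (card_sdiff_le_card_sdiff_iff.2 h.card_le)
    obtain ⟨he, hje⟩ := mem_filter.1 he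
    refine mem_sdiff.2 ⟨he, fun het ↦ ?_⟩
    simpa using (mem_powersetCard.1 (twinGraph_subset het)).1 hje
  obtain ⟨R, hR, hRcard⟩ := exists_subset_card_eq hmissing
  refine le_trans ?_ (h.weight_le_of_card_le (fun e he ↦ ?_) hRcard.le)
  · rw [← hRcard]
    refine card_mul_le_weight fun e he ↦ ?_
    have het := (mem_sdiff.1 (hR he)).1
    refine (mul_mul_le_prod_of_mem_twinGraph h.antitone h.nonneg het).trans
      (prod_le_prod (fun i _ ↦ h.nonneg i) fun i hi ↦ le_merge h.nonneg (by omega) ?_)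
    have := mem_range.1 ((mem_powersetCard.1 (twinGraph_subset het)).1 hi)
    omega
  · obtain ⟨het, heE⟩ := mem_sdiff.1 (hR he)
    exact mem_sdiff.2 ⟨twinGraph_subset het, heE⟩

end Coneighbors

/-! ### Supports with at least `r + 5` vertices -/

section LargeSupport

variable {E : Finset (Finset ℕ)} {x : ℕ → ℝ} {j k M r : ℕ}

/-- The Lagrangian of the complete `3`-graph on `n` vertices, attained at the uniform weighting. -/
noncomputable def completeValue (n : ℕ) : ℝ := n.choose 3 / n ^ 3

theorem weight_powersetCard_uniform {α : Type*} {s : Finset α} {x : α → ℝ}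
    (h : ∀ i ∈ s, x i = 1 / #s) : weight (powersetCard 3 s) x = completeValue #s := by
  have hprod : ∀ e ∈ powersetCard 3 s, ∏ i ∈ e, x i = (1 / #s) ^ 3 := fun e he ↦ by
    obtain ⟨hes, hcard⟩ := mem_powersetCard.1 he
    rw [prod_congr rfl fun i hi ↦ h i (hes hi), prod_const, hcard]
  rw [weight, sum_congr rfl hprod, sum_const, card_powersetCard, completeValue, nsmul_eq_mul,
    one_div, inv_pow, div_eq_mul_inv]

theorem six_mul_choose_three (r : ℕ) :
    6 * ((r + 3).choose 3 : ℝ) = (r + 3) * (r + 2) * (r + 1) := by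
  have h := Nat.descFactorial_eq_factorial_mul_choose (r + 3) 3
  simp only [Nat.descFactorial, Nat.factorial] at h
  rw [show r + 3 - 2 = r + 1 by omega, show r + 3 - 1 = r + 2 by omega] at h
  have h' : ((r + 1 : ℕ) * ((r + 2 : ℕ) * ((r + 3 : ℕ) * 1)) : ℝ) = 6 * (r + 3).choose 3 := by
    exact_mod_cast h
  push_cast at h'
  linarith

theorem six_mul_completeValue (r : ℕ) :
    6 * completeValue (r + 3) = (r + 2) * (r + 1) / (r + 3) ^ 2 := by
  rw [completeValue, ← mul_div_assoc, six_mul_choose_three]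
  push_cast
  field_simp

theorem completeValue_pos (r : ℕ) : 0 < completeValue (r + 3) := by
  have h := six_mul_completeValue r
  have : (0 : ℝ) < (r + 2) * (r + 1) / (r + 3) ^ 2 := by positivity
  linarith

theorem head_ratio_mono {p κ σ c : ℝ} (hp : 1 ≤ p) (hκ : 0 ≤ κ) (hσ₀ : 0 ≤ σ) (hσ₁ : σ ≤ 1)
    (h : c * (1 + κ + p * σ) ^ 2 ≤ (p * σ + κ) ^ 2 - p * σ ^ 2) :
    c * (1 + κ + p) ^ 2 ≤ (p + κ) ^ 2 - p := by
  have hdiff : ((p + κ) ^ 2 - p) * (1 + κ + p * σ) ^ 2 -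
      ((p * σ + κ) ^ 2 - p * σ ^ 2) * (1 + κ + p) ^ 2 =
      p * (1 - σ) * ((p - 1) * (1 + κ + p * σ) + (1 + κ + p) * (κ * (1 - σ) + (p - 1) * σ)) := by
    ring
  have hnonneg : 0 ≤ p * (1 - σ) *
      ((p - 1) * (1 + κ + p * σ) + (1 + κ + p) * (κ * (1 - σ) + (p - 1) * σ)) := by
    have := sub_nonneg.2 hp
    have := sub_nonneg.2 hσ₁
    positivity
  have hscaled := mul_le_mul_of_nonneg_right h (sq_nonneg (1 + κ + p))
  refine le_of_mul_le_mul_right ?_ (show 0 < (1 + κ + p * σ) ^ 2 by positivity)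
  linarith [hdiff, hnonneg, hscaled]

/-- Here `a` is the largest weight, `S` and `Q` are the sum and the square sum of the next `p`
weights, and `τ` is the weight of the remaining ones. The extreme case is that `S = p * a` and
`τ = κ * a`. -/
theorem head_tail_bound {p κ a S τ Q c : ℝ} (hp : 1 ≤ p) (hκ : 0 ≤ κ) (ha : 0 < a)
    (hsum : a + S + τ = 1) (hS₀ : 0 ≤ S) (hS : S ≤ p * a) (hτ₀ : 0 ≤ τ) (hτ : τ ≤ κ * a)
    (hQ : S ^ 2 ≤ p * Q) (h : c ≤ (1 - a) ^ 2 - Q) : c * (1 + κ + p) ^ 2 ≤ (p + κ) ^ 2 - p := by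
  have hp₀ : 0 < p := by linarith
  obtain ⟨σ, rfl⟩ : ∃ σ, S = p * a * σ := ⟨S / (p * a), by field_simp⟩
  have hpa : 0 < p * a := by positivity
  have hσ₀ : 0 ≤ σ := nonneg_of_mul_nonneg_right hS₀ hpa
  have hσ₁ : σ ≤ 1 := le_of_mul_le_mul_left (by simpa using hS) hpa
  refine head_ratio_mono hp hκ hσ₀ hσ₁ ?_
  set T := a * (1 + κ + p * σ) with hT
  have hT₁ : 1 ≤ T := by linarith
  have hQ' : p * (a * σ) ^ 2 ≤ Q := le_of_mul_le_mul_left (by linarith) hp₀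
  have hhead : (1 - a) * T ≤ T - a := by
    linarith [mul_le_mul_of_nonneg_left hT₁ ha.le]
  have hhead_sq : ((1 - a) * T) ^ 2 ≤ (T - a) ^ 2 :=
    pow_le_pow_left₀ (mul_nonneg (by linarith) (by linarith)) hhead 2
  have hsq : p * (a * σ) ^ 2 ≤ p * (a * σ) ^ 2 * T ^ 2 :=
    le_mul_of_one_le_right (by positivity) (one_le_pow₀ hT₁)
  have hc : c * T ^ 2 ≤ ((1 - a) ^ 2 - p * (a * σ) ^ 2) * T ^ 2 :=
    mul_le_mul_of_nonneg_right (by linarith) (sq_nonneg T)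
  refine le_of_mul_le_mul_left ?_ (show 0 < a ^ 2 by positivity)
  calc a ^ 2 * (c * (1 + κ + p * σ) ^ 2) = c * T ^ 2 := by rw [hT]; ring
    _ ≤ (T - a) ^ 2 - p * (a * σ) ^ 2 := by linarith
    _ = a ^ 2 * ((p * σ + κ) ^ 2 - p * σ ^ 2) := by rw [hT]; ring

/-- For `r = 2` and `r = 3` the bound on `j` gives a better ratio `κ` than the general `κ = 2`. -/
theorem head_tail_absurd (hr : 2 ≤ r) (hj : r + 3 ≤ j)
    (hM : (j + 1).choose 2 ≤ (r + 3).choose 3 + (r + 2).choose 2) {a S τ Q : ℝ} (ha : 0 < a)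
    (hsum : a + S + τ = 1) (hS₀ : 0 ≤ S) (hS : S ≤ (r - 1) * a) (hτ₀ : 0 ≤ τ)
    (hτ : τ * (j + 1) ≤ 2 * (j + 2 - r) * a) (hQ : S ^ 2 ≤ (r - 1) * Q)
    (h : 6 * completeValue (r + 3) ≤ (1 - a) ^ 2 - Q) : False := by
  rw [six_mul_completeValue] at h
  have hr' : (2 : ℝ) ≤ r := by exact_mod_cast hr
  have hj' : (r : ℝ) + 3 ≤ j := by exact_mod_cast hj
  have bound (κ : ℝ) (hκ : 0 ≤ κ) (hκj : 2 * ((j : ℝ) + 2 - r) ≤ κ * (j + 1)) :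
      (r + 2) * (r + 1) / (r + 3) ^ 2 * (1 + κ + (r - 1)) ^ 2 ≤ ((r - 1) + κ) ^ 2 - (r - 1) := by
    refine head_tail_bound (by linarith) hκ ha hsum hS₀ hS hτ₀ ?_ hQ h
    exact le_of_mul_le_mul_right (a := (j : ℝ) + 1) (by nlinarith) (by positivity)
  rcases lt_or_ge r 4 with hr₄ | hr₄
  · have hj_lt (n : ℕ) (hn : (r + 3).choose 3 + (r + 2).choose 2 < n.choose 2) : j + 1 < n :=
      lt_of_not_ge fun hnj ↦ (hM.trans_lt hn).not_ge (Nat.choose_le_choose 2 hnj)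
    interval_cases r
    · have hj₅ : (j : ℝ) ≤ 5 := by
        exact_mod_cast (by have := hj_lt 7 (by decide); omega : j ≤ 5)
      have := bound (5 / 3) (by norm_num) (by push_cast; linarith)
      norm_num at this
    · have hj₇ : (j : ℝ) ≤ 7 := by
        exact_mod_cast (by have := hj_lt 9 (by decide); omega : j ≤ 7)
      have := bound (3 / 2) (by norm_num) (by push_cast; linarith)
      norm_num at this
  · have hr₄' : (4 : ℝ) ≤ r := by exact_mod_cast hr₄
    have := bound 2 (by norm_num) (by linarith)
    rw [div_mul_eq_mul_div, div_le_iff₀ (by positivity)] at this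
    nlinarith [mul_nonneg (sub_nonneg.2 hr₄') (sub_nonneg.2 hr₄')]

theorem IsShiftedOptimum.degree_last_pos (h : IsShiftedOptimum (j + 2) M E x)
    (hweight : 0 < weight E x) : 0 < #{e ∈ E | j + 1 ∈ e} := by
  obtain ⟨e, he, hje⟩ := h.exists_mem_edge h.pos_of_mem hweight (show j + 1 ∈ range (j + 2) by simp)
  exact card_pos.2 ⟨e, mem_filter.2 ⟨he, hje⟩⟩

theorem IsShiftedOptimum.degree_last_mul_le_card_coneighbors_mul (hj : r + 3 ≤ j)
    (h : IsShiftedOptimum (j + 2) #(twinGraph r) E x) :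
    #{e ∈ E | j + 1 ∈ e} * x r ≤ #(coneighbors E j) * x 0 := by
  have hy : 0 < x (j + 1) := h.pos _ (by omega)
  have hr : 0 < x r := h.pos _ (by omega)
  have hprod : x r * x (j + 1) ^ 2 ≤ x r * x (r + 1) * x (r + 3) := by
    rw [mul_assoc, sq]
    exact mul_le_mul_of_nonneg_left (mul_le_mul (h.antitone (by omega)) (h.antitone (by omega))
      hy.le (h.nonneg _)) hr.le
  have hsum : ∑ i ∈ coneighbors E j, x i ≤ #(coneighbors E j) * x 0 := by
    simpa using sum_le_card_nsmul (coneighbors E j) x (x 0) fun i _ ↦ h.antitone (Nat.zero_le i)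
  refine le_of_mul_le_mul_right ?_ (show 0 < x (j + 1) ^ 2 by positivity)
  calc #{e ∈ E | j + 1 ∈ e} * x r * x (j + 1) ^ 2
      = #{e ∈ E | j + 1 ∈ e} * (x r * x (j + 1) ^ 2) := by ring
    _ ≤ #{e ∈ E | j + 1 ∈ e} * (x r * x (r + 1) * x (r + 3)) := by gcongr
    _ ≤ x (j + 1) ^ 2 * ∑ i ∈ coneighbors E j, x i := h.degree_last_mul_le hj
    _ ≤ x (j + 1) ^ 2 * (#(coneighbors E j) * x 0) := by gcongr
    _ = #(coneighbors E j) * x 0 * x (j + 1) ^ 2 := by ring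

theorem IsShiftedOptimum.coneighbors_nonempty (hj : r + 3 ≤ j)
    (h : IsShiftedOptimum (j + 2) #(twinGraph r) E x) (hweight : 0 < weight E x) :
    (coneighbors E j).Nonempty := by
  by_contra hne
  have hle := h.degree_last_mul_le_card_coneighbors_mul hj
  rw [not_nonempty_iff_eq_empty.1 hne, card_empty, Nat.cast_zero, zero_mul] at hle
  have := h.degree_last_pos hweight
  have := h.pos r (by omega)
  exact absurd hle (not_le.2 (by positivity))

theorem IsShiftedOptimum.succ_mul_le_two_mul (hj : r + 3 ≤ j)
    (h : IsShiftedOptimum (j + 2) #(twinGraph r) E x) (hweight : 0 < weight E x) :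
    (j + 1) * x r ≤ 2 * x 0 := by
  have hB : (0 : ℝ) < #(coneighbors E j) := by
    exact_mod_cast card_pos.2 (h.coneighbors_nonempty hj hweight)
  have hcount : #(coneighbors E j) * ((j : ℝ) + 1) ≤ 2 * #{e ∈ E | j + 1 ∈ e} := by
    exact_mod_cast h.compressed.card_coneighbors_mul_le h.card_edge j
  refine le_of_mul_le_mul_left ?_ hB
  calc #(coneighbors E j) * ((j + 1) * x r) = #(coneighbors E j) * ((j : ℝ) + 1) * x r := by ring
    _ ≤ 2 * #{e ∈ E | j + 1 ∈ e} * x r := by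
      gcongr
      exact h.nonneg r
    _ ≤ #(coneighbors E j) * (2 * x 0) := by
      linarith [h.degree_last_mul_le_card_coneighbors_mul hj]

theorem IsShiftedOptimum.sum_tail_mul_le (hj : r + 3 ≤ j)
    (h : IsShiftedOptimum (j + 2) #(twinGraph r) E x) (hweight : 0 < weight E x) :
    (∑ i ∈ Ico r (j + 2), x i) * (j + 1) ≤ 2 * (j + 2 - r) * x 0 := by
  have htail : (#(Ico r (j + 2)) : ℝ) = j + 2 - r := by
    rw [Nat.card_Ico, Nat.cast_sub (by omega)]
    push_cast
    ring
  have htail_le : ∑ i ∈ Ico r (j + 2), x i ≤ (j + 2 - r) * x r := by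
    rw [← htail, ← nsmul_eq_mul]
    exact sum_le_card_nsmul _ _ _ fun i hi ↦ h.antitone (mem_Ico.1 hi).1
  have htail_nonneg : (0 : ℝ) ≤ j + 2 - r := by rw [← htail]; positivity
  calc (∑ i ∈ Ico r (j + 2), x i) * (j + 1) ≤ (j + 2 - r) * x r * (j + 1) := by gcongr
    _ = (j + 2 - r) * ((j + 1) * x r) := by ring
    _ ≤ (j + 2 - r) * (2 * x 0) :=
      mul_le_mul_of_nonneg_left (h.succ_mul_le_two_mul hj hweight) htail_nonneg
    _ = 2 * (j + 2 - r) * x 0 := by ring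

theorem Compressed.choose_two_le_card (hE : Compressed E) (hB : (coneighbors E j).Nonempty) :
    (j + 1).choose 2 ≤ #E := by
  have notMem {p : Finset ℕ} (hp : p ∈ powersetCard 2 ((range (j + 2)).erase 0)) : 0 ∉ p :=
    fun h ↦ by simpa using (mem_powersetCard.1 hp).1 h
  have hcard : #(powersetCard 2 ((range (j + 2)).erase 0)) = (j + 1).choose 2 := by
    rw [card_powersetCard, card_erase_of_mem (by simp), card_range]
    rfl
  rw [← hcard]
  refine card_le_card_of_injOn (insert 0) (fun p ↦ hE.insert_mem (hE.zero_mem_coneighbors hB))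
    fun p hp q hq hpq ↦ ?_
  rw [← erase_insert (notMem hp), ← erase_insert (notMem hq), hpq]

theorem IsShiftedOptimum.weight_lt_of_large_support (hr : 2 ≤ r) (hj : r + 3 ≤ j)
    (h : IsShiftedOptimum (j + 2) #(twinGraph r) E x) :
    weight E x < completeValue (r + 3) := by
  by_contra! hweight
  have hpos : 0 < weight E x := (completeValue_pos r).trans_le hweight
  have hM : (j + 1).choose 2 ≤ (r + 3).choose 3 + (r + 2).choose 2 :=
    card_twinGraph r ▸
      (h.compressed.choose_two_le_card (h.coneighbors_nonempty hj hpos)).trans h.card_le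
  have hsum : x 0 + ∑ i ∈ Ico 1 r, x i + ∑ i ∈ Ico r (j + 2), x i = 1 := by
    rw [← h.sum_eq, range_eq_Ico, ← sum_Ico_consecutive x (Nat.zero_le r) (by omega),
      ← sum_Ico_consecutive x (Nat.zero_le 1) (by omega)]
    simp
  have hhead : (#(Ico 1 r) : ℝ) = r - 1 := by
    rw [Nat.card_Ico, Nat.cast_sub (by omega), Nat.cast_one]
  refine head_tail_absurd hr hj hM (h.pos 0 (by omega)) hsum (sum_nonneg fun i _ ↦ h.nonneg i) ?_
    (sum_nonneg fun i _ ↦ h.nonneg i) ?_ (Q := ∑ i ∈ Ico 1 r, x i ^ 2) ?_ ?_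
  · rw [← hhead, ← nsmul_eq_mul]
    exact sum_le_card_nsmul _ _ _ fun i _ ↦ h.antitone (Nat.zero_le i)
  · exact h.sum_tail_mul_le hj hpos
  · rw [← hhead]
    exact sq_sum_le_card_mul_sum_sq
  · have hsq : ∑ i ∈ Ico 1 r, x i ^ 2 ≤ ∑ i ∈ (range (j + 2)).erase 0, x i ^ 2 := by
      refine sum_le_sum_of_subset_of_nonneg (fun i hi ↦ ?_) fun i _ _ ↦ sq_nonneg _
      simp only [mem_Ico, mem_erase, mem_range] at hi ⊢
      omega
    have := h.six_mul_weight_le h.pos_of_mem (show 0 ∈ range (j + 2) by simp)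
    linarith

end LargeSupport

/-! ### The numerical inequality for supports with `r + 4` vertices -/

section TwinInequality

variable {b g K α ζ V : ℝ}

theorem quartic_pos_of_le_two (h₁ : 1 / 2 ≤ g) (h₂ : g ≤ 5 / 4) :
    0 < 17 / 6 * (1 - g) ^ 2 - (g + g ^ 2 / 4 - 2 * g ^ 3 + 6 / 17 * g ^ 4) := by
  have h₁' := sub_nonneg.2 h₁
  have h₂' := sub_nonneg.2 h₂
  nlinarith [mul_nonneg (mul_nonneg h₁' h₂') (sq_nonneg (g - 3 / 4)),
    mul_nonneg h₁' (sq_nonneg (g - 3 / 4)), mul_nonneg h₂' (sq_nonneg (g - 3 / 4))]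

theorem cubic_pos (h : 1 / 2 ≤ g) : 0 < 2 * (1 - g) ^ 2 - (g + g ^ 2 / 4 - 2 * g ^ 3) := by
  nlinarith [mul_nonneg (by linarith : 0 ≤ 2 * g + 53 / 12) (sq_nonneg (g - 2 / 3))]

theorem quartic_pos_of_three_le (h₁ : 1 / 2 ≤ g) (h₂ : g ≤ 5 / 4) :
    0 < 23 / 6 * (2 * (1 - g) ^ 2 - (g + g ^ 2 / 4 - 2 * g ^ 3)) +
      (5 / 3 * (1 - g) ^ 2 - g ^ 4) := by
  have h₁' := sub_nonneg.2 h₁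
  have h₂' := sub_nonneg.2 h₂
  nlinarith [mul_nonneg (mul_nonneg h₁' h₂') (sq_nonneg (g - 7 / 10)),
    mul_nonneg h₁' (sq_nonneg (g - 7 / 10)), mul_nonneg h₂' (sq_nonneg (g - 7 / 10))]

theorem mul_mul_sub_sq_le (hK : 0 < K) (hg : 0 < g) (hζ₀ : 0 ≤ ζ) (hζ : ζ ≤ 2 * g) :
    α * g * ζ - K * (α - 1) ^ 2 ≤ g * ζ + g ^ 4 / K := by
  have hsquare : 2 * (α - 1) * g ^ 2 - K * (α - 1) ^ 2 ≤ g ^ 4 / K := by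
    rw [le_div_iff₀ hK]
    linarith [sq_nonneg (g ^ 2 - K * (α - 1))]
  rcases le_or_gt 1 α with hα | hα
  · have : (α - 1) * g * ζ ≤ (α - 1) * g * (2 * g) :=
      mul_le_mul_of_nonneg_left hζ (mul_nonneg (sub_nonneg.2 hα) hg.le)
    linarith
  · have : 0 ≤ (1 - α) * (g * ζ) := mul_nonneg (by linarith) (by positivity)
    have : 0 ≤ K * (α - 1) ^ 2 := by positivity
    have : 0 ≤ g ^ 4 / K := by positivity
    linarith

/-- The variables `α` and `ζ` are eliminated by completing squares. -/
theorem two_mul_mul_sq_le (hb : 0 ≤ b) (hK : 0 < K) (hg : 0 < g) (hζ₀ : 0 ≤ ζ) (hζ : ζ ≤ 2 * g)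
    (hV : 2 * (1 - g) ^ 2 ≤ V)
    (h : K * (b * (α - 1) ^ 2 + V) + b * (ζ - 1) ^ 2 ≤ b * (α * g * ζ - 2 * g ^ 3)) :
    2 * K * (1 - g) ^ 2 ≤ b * (g + g ^ 2 / 4 - 2 * g ^ 3 + g ^ 4 / K) := by
  have hV' := mul_le_mul_of_nonneg_left hV hK.le
  have hα := mul_le_mul_of_nonneg_left (mul_mul_sub_sq_le (α := α) hK hg hζ₀ hζ) hb
  have hζ' : b * (g * ζ - (ζ - 1) ^ 2) ≤ b * (g + g ^ 2 / 4) :=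
    mul_le_mul_of_nonneg_left (by linarith [sq_nonneg (ζ - 1 - g / 2)]) hb
  linarith

theorem not_two_mul_mul_sq_le_of_le_two (hb₀ : 0 < b) (hb : b ≤ 2) (hK : 17 / 6 ≤ K)
    (hg₁ : 1 / 2 ≤ g) (hg₂ : g ≤ 5 / 4) :
    ¬ 2 * K * (1 - g) ^ 2 ≤ b * (g + g ^ 2 / 4 - 2 * g ^ 3 + g ^ 4 / K) := fun h ↦ by
  have hquartic := quartic_pos_of_le_two hg₁ hg₂
  have hdiv : g ^ 4 / K ≤ 6 / 17 * g ^ 4 := by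
    rw [div_le_iff₀ (by linarith)]
    nlinarith [pow_pos (by linarith : 0 < g) 4]
  have hleft : 2 * (17 / 6) * (1 - g) ^ 2 ≤ 2 * K * (1 - g) ^ 2 := by gcongr
  have hright : b * (g + g ^ 2 / 4 - 2 * g ^ 3 + g ^ 4 / K) ≤
      b * (g + g ^ 2 / 4 - 2 * g ^ 3 + 6 / 17 * g ^ 4) := by gcongr
  linarith [mul_pos hb₀ hquartic, mul_nonneg (sub_nonneg.2 hb) (sq_nonneg (1 - g))]

theorem not_two_mul_mul_sq_le_of_three_le (hb : 3 ≤ b) (hK : b + 5 / 6 ≤ K)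
    (hg₁ : 1 / 2 ≤ g) (hg₂ : g ≤ 5 / 4) :
    ¬ 2 * K * (1 - g) ^ 2 ≤ b * (g + g ^ 2 / 4 - 2 * g ^ 3 + g ^ 4 / K) := fun h ↦ by
  set k := b + 5 / 6 with hk
  have hk₀ : 0 < k := by linarith
  have hle : 2 * k * (1 - g) ^ 2 ≤ b * (g + g ^ 2 / 4 - 2 * g ^ 3 + g ^ 4 / k) :=
    calc 2 * k * (1 - g) ^ 2 ≤ 2 * K * (1 - g) ^ 2 := by gcongr
      _ ≤ b * (g + g ^ 2 / 4 - 2 * g ^ 3 + g ^ 4 / K) := h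
      _ ≤ b * (g + g ^ 2 / 4 - 2 * g ^ 3 + g ^ 4 / k) := by gcongr
  have hle' : 2 * k ^ 2 * (1 - g) ^ 2 ≤ b * (k * (g + g ^ 2 / 4 - 2 * g ^ 3) + g ^ 4) := by
    calc 2 * k ^ 2 * (1 - g) ^ 2 = k * (2 * k * (1 - g) ^ 2) := by ring
      _ ≤ k * (b * (g + g ^ 2 / 4 - 2 * g ^ 3 + g ^ 4 / k)) :=
        mul_le_mul_of_nonneg_left hle hk₀.le
      _ = b * (k * (g + g ^ 2 / 4 - 2 * g ^ 3) + g ^ 4) := by field_simp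
  have hcubic := mul_nonneg (by linarith : 0 ≤ k - 23 / 6) (cubic_pos hg₁).le
  have hpos := mul_pos (by linarith : 0 < b) <|
    add_pos_of_pos_of_nonneg (quartic_pos_of_three_le hg₁ hg₂) hcubic
  have hsq : b * (k + 5 / 6) = k ^ 2 - 25 / 36 := by rw [hk]; ring
  have hprod : 2 * (1 - g) ^ 2 * (b * (k + 5 / 6)) ≤ 2 * (1 - g) ^ 2 * k ^ 2 :=
    mul_le_mul_of_nonneg_left (by linarith) (by positivity)
  linarith

theorem twin_absurd_of_lt_half (hb : 1 ≤ b) (hK : b ≤ K) (hg₀ : 0 < g) (hg : g < 1 / 2)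
    (hα : α ≤ 5 / 4) (hζ₀ : 0 ≤ ζ) (hζ : ζ ≤ 2 * g) (hV : 1 - 2 * g ^ 2 ≤ V)
    (h : K * (b * (α - 1) ^ 2 + V) + b * (ζ - 1) ^ 2 ≤ b * (α * g * ζ - 2 * g ^ 3)) : False := by
  have hV₀ : 0 ≤ V := by nlinarith
  have hle : b * V ≤ b * (α * g * ζ - 2 * g ^ 3) := by
    have : b * V ≤ K * V := mul_le_mul_of_nonneg_right hK hV₀
    have : 0 ≤ K * (b * (α - 1) ^ 2) := mul_nonneg (by linarith) (by positivity)
    have : 0 ≤ b * (ζ - 1) ^ 2 := by positivity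
    linarith
  have hV' := le_of_mul_le_mul_left hle (by linarith)
  have : α * g * ζ ≤ 5 / 4 * g * (2 * g) := by gcongr
  nlinarith [mul_pos hg₀ hg₀, mul_pos (mul_pos hg₀ hg₀) hg₀]

theorem twin_absurd {K' : ℝ} (hb : 1 ≤ b) (hb' : b ≤ 2 ∨ 3 ≤ b) (hK : b + 5 / 6 ≤ K)
    (hK₀ : 17 / 6 ≤ K) (hK' : b ≤ K') (hg : 0 < g) (hα : α ≤ 5 / 4) (hgα : g ≤ α) (hζ₀ : 0 ≤ ζ)
    (hζ : ζ ≤ 2 * g) (hV₁ : 1 / 2 ≤ g → 2 * (1 - g) ^ 2 ≤ V) (hV₂ : 1 - 2 * g ^ 2 ≤ V)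
    (h : K * (b * (α - 1) ^ 2 + V) + K' * (ζ - 1) ^ 2 ≤ b * (α * g * ζ - 2 * g ^ 3)) : False := by
  have hζ' : b * (ζ - 1) ^ 2 ≤ K' * (ζ - 1) ^ 2 := by gcongr
  have h' : K * (b * (α - 1) ^ 2 + V) + b * (ζ - 1) ^ 2 ≤ b * (α * g * ζ - 2 * g ^ 3) := by
    linarith
  rcases lt_or_ge g (1 / 2) with hg₁ | hg₁
  · exact twin_absurd_of_lt_half hb (by linarith) hg hg₁ hα hζ₀ hζ hV₂ h'
  have hreduced := two_mul_mul_sq_le (by linarith) (by linarith) hg hζ₀ hζ (hV₁ hg₁) h'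
  rcases hb' with hb₂ | hb₃
  · exact not_two_mul_mul_sq_le_of_le_two (by linarith) hb₂ hK₀ hg₁ (hgα.trans hα) hreduced
  · exact not_two_mul_mul_sq_le_of_three_le hb₃ hK hg₁ (hgα.trans hα) hreduced

theorem two_mul_one_sub_sq_le {v₁ v₂ : ℝ} (h : g ^ 2 = v₁ * v₂) (hv : 0 ≤ v₁ + v₂)
    (hg : 1 / 2 ≤ g) : 2 * (1 - g) ^ 2 ≤ (v₁ - 1) ^ 2 + (v₂ - 1) ^ 2 := by
  have amgm : 2 * g ≤ v₁ + v₂ :=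
    abs_le_of_sq_le_sq' (by linarith [sq_nonneg (v₁ - v₂)]) hv |>.2
  linarith [mul_nonneg (sub_nonneg.2 amgm) (by linarith : 0 ≤ v₁ + v₂ + 2 * g - 2)]

/-- The weights are measured in units of `1 / n`; the two weights `v₁, v₂` are replaced by their
geometric mean. -/
theorem twin_absurd_of_sorted {K' v₁ v₂ ω η : ℝ} (hb : 1 ≤ b) (hb' : b ≤ 2 ∨ 3 ≤ b)
    (hK : b + 5 / 6 ≤ K) (hK₀ : 17 / 6 ≤ K) (hK' : b ≤ K') (hα : α ≤ 5 / 4) (hv₁ : v₁ ≤ α)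
    (hv₂ : v₂ ≤ v₁) (hω : ω ≤ v₂) (hηω : η ≤ ω) (hη : 0 < η) (hex : v₁ * v₂ ≤ α * η)
    (h : b * (ω + η) * (v₁ * v₂) + (K * (b * (α - 1) ^ 2 + ((v₁ - 1) ^ 2 + (v₂ - 1) ^ 2)) +
      K' * (ω + η - 1) ^ 2) ≤ b * α * (ω ^ 2 + η ^ 2)) : False := by
  have hv₂₀ : 0 < v₂ := by linarith
  have hv₁₀ : 0 < v₁ := by linarith
  obtain ⟨g, hg₀, hg⟩ : ∃ g, 0 < g ∧ g ^ 2 = v₁ * v₂ :=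
    ⟨√(v₁ * v₂), Real.sqrt_pos.2 (by positivity), Real.sq_sqrt (by positivity)⟩
  rw [← hg] at h hex
  have hωg : ω ≤ g := abs_le_of_sq_le_sq' (by nlinarith) hg₀.le |>.2
  have hgα : g ≤ α := abs_le_of_sq_le_sq' (by nlinarith) (by linarith) |>.2
  refine twin_absurd hb hb' hK hK₀ hK' hg₀ hα hgα (ζ := ω + η) (by linarith) (by linarith)
    (two_mul_one_sub_sq_le hg (by linarith)) (by linarith [sq_nonneg (v₁ + v₂ - 1)]) ?_
  have hω' : 0 ≤ (g - ω) * (α * ω - g ^ 2) := mul_nonneg (by linarith)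
    (by linarith [mul_le_mul_of_nonneg_left hηω (by linarith : 0 ≤ α)])
  have hη' : 0 ≤ (g - η) * (α * η - g ^ 2) := mul_nonneg (by linarith) (by linarith)
  have : b * (α * (ω ^ 2 + η ^ 2)) ≤ b * ((α * g + g ^ 2) * (ω + η) - 2 * g ^ 3) :=
    mul_le_mul_of_nonneg_left (by linarith) (by linarith)
  linarith

theorem twin_absurd_scaled {n a p q w y : ℝ} (hn : 5 ≤ n) (hb : 1 ≤ b) (hb' : b ≤ 2 ∨ 3 ≤ b)
    (hbn : b ≤ n - 3) (ha : a ≤ 1 / (n - 1)) (hp : p ≤ a) (hq : q ≤ p) (hw : w ≤ q) (hyw : y ≤ w)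
    (hy : 0 < y) (hex : p * q ≤ a * y)
    (h : 3 * b * (w + y) * (p * q) + ((3 - 4 / n - 2 / (n - 1)) *
        (b * (a - 1 / n) ^ 2 + ((p - 1 / n) ^ 2 + (q - 1 / n) ^ 2)) +
        (3 - 4 / n - 4 / (n + 1)) * (w + y - 1 / n) ^ 2) ≤ 3 * b * a * (w ^ 2 + y ^ 2)) :
    False := by
  have hn₀ : 0 < n := by linarith
  have hn₁ : 0 < n - 1 := by linarith
  have hK : n * (3 - 4 / n - 2 / (n - 1)) / 3 = n - 2 - 2 / (3 * (n - 1)) := by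
    field_simp
    ring
  have hK' : n * (3 - 4 / n - 4 / (n + 1)) / 3 = n - 8 / 3 + 4 / (3 * (n + 1)) := by
    field_simp
    ring
  have hdiv : 2 / (3 * (n - 1)) ≤ 1 / 6 := by
    rw [div_le_div_iff₀ (by positivity) (by norm_num)]
    linarith
  have hdiv' : 0 ≤ 4 / (3 * (n + 1)) := by positivity
  have hα : n * a ≤ 5 / 4 := by
    rw [le_div_iff₀ hn₁] at ha
    nlinarith
  have hex' : n * p * (n * q) ≤ n * a * (n * y) := by
    linarith [mul_le_mul_of_nonneg_left hex (sq_nonneg n)]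
  refine twin_absurd_of_sorted hb hb' (K := n * (3 - 4 / n - 2 / (n - 1)) / 3)
    (K' := n * (3 - 4 / n - 4 / (n + 1)) / 3) (by rw [hK]; linarith) (by rw [hK]; linarith)
    (by rw [hK']; linarith) hα (mul_le_mul_of_nonneg_left hp hn₀.le)
    (mul_le_mul_of_nonneg_left hq hn₀.le) (mul_le_mul_of_nonneg_left hw hn₀.le)
    (mul_le_mul_of_nonneg_left hyw hn₀.le) (by positivity) hex' ?_
  have hsq (t : ℝ) : (n * t - 1) ^ 2 = n ^ 2 * (t - 1 / n) ^ 2 := by field_simp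
  rw [hsq, hsq, hsq, ← mul_add n w y, hsq]
  linarith [mul_le_mul_of_nonneg_left h (show 0 ≤ n ^ 3 / 3 by positivity)]

end TwinInequality

/-! ### Supports with `r + 4` vertices -/

section Deviation

variable {α : Type*} {s : Finset α} {x : α → ℝ} {r : ℕ}

/-- A measure of the distance of a weighting of `s` from the uniform one: it is the amount by which
the cubic elementary symmetric sum, up to the factor `6`, falls short of its maximum. -/
noncomputable def deviation (s : Finset α) (x : α → ℝ) : ℝ :=
  ∑ i ∈ s, (x i - 1 / #s) ^ 2 * (3 - 4 / #s - 2 * x i)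

theorem six_mul_weight_add_deviation (hs : #s = r + 3) (hsum : ∑ i ∈ s, x i = 1) :
    6 * weight (powersetCard 3 s) x + deviation s x = 6 * completeValue (r + 3) := by
  have hn : (r : ℝ) + 3 ≠ 0 := by positivity
  have term (i : α) : (x i - 1 / ((r : ℝ) + 3)) ^ 2 * (3 - 4 / (r + 3) - 2 * x i) =
      3 * x i ^ 2 - 2 * x i ^ 3 - (6 / (r + 3) - 6 / (r + 3) ^ 2) * x i +
        (3 / (r + 3) ^ 2 - 4 / (r + 3) ^ 3) := by
    field_simp
    ring
  rw [deviation, hs, six_mul_weight_powersetCard_three, hsum, six_mul_completeValue]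
  push_cast
  simp only [term, sum_add_distrib, sum_sub_distrib, ← mul_sum, hsum, sum_const, hs, nsmul_eq_mul]
  push_cast
  field_simp
  ring

theorem eq_of_completeValue_le (hr : 2 ≤ r) (hs : #s = r + 3) (hx : ∀ i ∈ s, 0 ≤ x i)
    (hsum : ∑ i ∈ s, x i = 1) (h : completeValue (r + 3) ≤ weight (powersetCard 3 s) x) :
    ∀ i ∈ s, x i = 1 / (r + 3) := by
  have hr' : (2 : ℝ) ≤ r := by exact_mod_cast hr
  have hdiv : 4 / ((r : ℝ) + 3) ≤ 4 / 5 := by gcongr; linarith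
  have factor_pos : ∀ i ∈ s, 0 < 3 - 4 / ((r : ℝ) + 3) - 2 * x i := fun i hi ↦ by
    have : x i ≤ 1 := hsum ▸ single_le_sum hx hi
    linarith
  have term_nonneg : ∀ i ∈ s, 0 ≤ (x i - 1 / ((r : ℝ) + 3)) ^ 2 * (3 - 4 / (r + 3) - 2 * x i) :=
    fun i hi ↦ mul_nonneg (sq_nonneg _) (factor_pos i hi).le
  have hdev := six_mul_weight_add_deviation hs hsum
  rw [deviation, hs] at hdev
  push_cast at hdev
  have hzero := (sum_eq_zero_iff_of_nonneg term_nonneg).1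
    (le_antisymm (by linarith) (sum_nonneg term_nonneg))
  intro i hi
  have hsq := (mul_eq_zero.1 (hzero i hi)).resolve_right (factor_pos i hi).ne'
  exact sub_eq_zero.1 (pow_eq_zero_iff two_ne_zero |>.1 hsq)

theorem IsWeighting.uniform_of_completeValue_le {E : Finset (Finset α)} (hr : 2 ≤ r)
    (hs : #s = r + 3) (hx : IsWeighting s x) (hE : E ⊆ powersetCard 3 s)
    (h : completeValue (r + 3) ≤ weight E x) :
    weight E x = completeValue (r + 3) ∧ ∀ i ∈ s, x i = 1 / (r + 3) := by
  have hle := weight_mono hx.nonneg hE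
  have uniform := eq_of_completeValue_le hr hs (fun i _ ↦ hx.nonneg i)
    hx.sum_eq (h.trans hle)
  have hvalue : weight (powersetCard 3 s) x = completeValue #s :=
    weight_powersetCard_uniform (by simpa [hs] using uniform)
  rw [hvalue, hs] at hle
  exact ⟨hle.antisymm h, uniform⟩

end Deviation

section UniversalVertex

variable {α : Type*} [DecidableEq α] {U : Finset α} {M : ℕ} {E : Finset (Finset α)} {x : α → ℝ}
  {v i : α}

theorem IsWeighting.sum_erase_erase (h : IsWeighting U x) (hv : v ∈ U) (hi : i ∈ U) (hvi : v ≠ i) :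
    ∑ l ∈ (U.erase v).erase i, x l = 1 - x v - x i := by
  rw [← h.sum_eq, ← sum_erase_add U x hv,
    ← sum_erase_add (U.erase v) x (mem_erase.2 ⟨hvi.symm, hi⟩)]
  ring

/-- The first-order conditions at `v` and `i`, when `v` forms an edge with any two vertices. -/
theorem IsOptimal.sub_mul_eq_weight_colink (h : IsOptimal 3 U M E x) (hpos : ∀ l ∈ U, 0 < x l)
    (hv : v ∈ U) (hi : i ∈ U) (hvi : v ≠ i)
    (huniv : ∀ p ∈ powersetCard 2 (U.erase v), insert v p ∈ E) :
    (x v - x i) * (1 - x v - x i) = weight (colink E ((U.erase v).erase i) {i} 2) x := by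
  have hiv : i ∈ U.erase v := mem_erase.2 ⟨hvi.symm, hi⟩
  have balance := h.weight_link_balance hv hi hvi (hpos v hv) (hpos i hi)
  have codegree : link E ((U.erase v).erase i) {v, i} 1 =
      powersetCard 1 ((U.erase v).erase i) := link_eq_powersetCard fun p hp ↦ by
    obtain ⟨hp, hcard⟩ := mem_powersetCard.1 hp
    obtain ⟨l, rfl⟩ := card_eq_one.1 hcard
    have hl := mem_erase.1 (singleton_subset_iff.1 hp)
    rw [insert_union, ← insert_eq]
    exact huniv {i, l} (mem_powersetCard.2
      ⟨insert_subset hiv (singleton_subset_iff.2 hl.2), card_pair hl.1.symm⟩)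
  have degree : link E ((U.erase v).erase i) {v} 2 =
      powersetCard 2 ((U.erase v).erase i) := link_eq_powersetCard fun p hp ↦
    huniv p (powersetCard_mono (erase_subset _ _) hp)
  rw [codegree, degree, weight_powersetCard_one, h.sum_erase_erase hv hi hvi] at balance
  linear_combination
    -balance - weight_link_add_weight_colink E ((U.erase v).erase i) {i} 2 x

theorem IsOptimal.eq_of_universal (h : IsOptimal 3 U M E x) (hpos : ∀ l ∈ U, 0 < x l) (hv : v ∈ U)
    (hi : i ∈ U) (hne : ((U.erase v).erase i).Nonempty)
    (huniv : ∀ p ∈ powersetCard 2 (U.erase v), insert v p ∈ E)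
    (huniv' : ∀ p ∈ powersetCard 2 (U.erase i), insert i p ∈ E) : x v = x i := by
  rcases eq_or_ne v i with rfl | hvi
  · rfl
  have hsum : 0 < 1 - x v - x i := h.sum_erase_erase hv hi hvi ▸
    sum_pos (fun l hl ↦ hpos l (mem_of_mem_erase (mem_of_mem_erase hl))) hne
  have hfirst := h.sub_mul_eq_weight_colink hpos hv hi hvi huniv
  rw [colink_eq_empty fun p hp ↦ huniv' p (powersetCard_mono
    (erase_subset_erase _ (erase_subset _ _)) hp), weight, sum_empty] at hfirst
  exact sub_eq_zero.1 ((mul_eq_zero.1 hfirst).resolve_right hsum.ne')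

end UniversalVertex

section LastPair

variable {E : Finset (Finset ℕ)} {x : ℕ → ℝ} {i j k M r : ℕ}

theorem IsShiftedOptimum.eq_of_mem_coneighbors (h : IsShiftedOptimum (j + 2) M E x)
    (hi : i ∈ coneighbors E j) : x i = x 0 := by
  have hij := (mem_coneighbors.1 hi).1
  refine h.eq_of_universal h.pos_of_mem (by simp; omega) (by simp) ⟨j, by simp; omega⟩
    (fun _ ↦ h.compressed.insert_mem hi)
    fun _ ↦ h.compressed.insert_mem (h.compressed.zero_mem_coneighbors ⟨i, hi⟩)

theorem IsShiftedOptimum.sum_coneighbors (h : IsShiftedOptimum (j + 2) M E x) :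
    ∑ i ∈ coneighbors E j, x i = #(coneighbors E j) * x 0 := by
  rw [sum_congr rfl fun i ↦ h.eq_of_mem_coneighbors, sum_const, nsmul_eq_mul]

theorem card_link_add_card_colink {α : Type*} [DecidableEq α] (E : Finset (Finset α))
    (s t : Finset α) (k : ℕ) : #(link E s t k) + #(colink E s t k) = (#s).choose k := by
  rw [← card_powersetCard]
  exact card_filter_add_card_filter_not _

theorem card_coneighbors_le (hE : E ⊆ powersetCard 3 (range (j + 2)))
    (hcard : #E ≤ (j + 1).choose 3 + j.choose 2) :
    #(coneighbors E j) ≤ #(colink E (range j) ∅ 3) + #(colink E (range j) {j} 2) +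
      #(colink E (range j) {j + 1} 2) := by
  have split := weight_split_pair hE (i := j) (j := j + 1) (by simp) (by simp) (by simp)
    fun _ ↦ (1 : ℝ)
  rw [erase_erase_range, weight_link_last] at split
  simp only [weight_one, one_mul, sum_const, nsmul_eq_mul, mul_one, Nat.reduceAdd] at split
  norm_cast at split
  have h₀ := card_link_add_card_colink E (range j) ∅ 3
  have h₁ := card_link_add_card_colink E (range j) {j} 2
  have h₂ := card_link_add_card_colink E (range j) {j + 1} 2
  have hchoose : (j + 1).choose 3 = j.choose 2 + j.choose 3 := Nat.choose_succ_succ ..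
  simp only [card_range] at h₀ h₁ h₂
  omega

theorem Compressed.insert_mem_of_lt (hE : Compressed E) {p : Finset ℕ} (hij : i < j) (hi : i ∉ p)
    (hj : j ∉ p) (h : insert j p ∈ E) : insert i p ∈ E := by
  simpa [hj] using hE _ h j (mem_insert_self j p) i hij (by simp [hi, hij.ne])

/-- The balance of the last two vertices, in terms of the numbers of missing edges. -/
theorem IsShiftedOptimum.card_colink_sub_mul_le (h : IsShiftedOptimum (r + 4) M E x) :
    ((#(colink E (range (r + 2)) {r + 3} 2) : ℝ) - #(colink E (range (r + 2)) {r + 2} 2)) *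
        (x r * x (r + 1)) ≤
      (x (r + 2) - x (r + 3)) * ∑ i ∈ coneighbors E (r + 2), x i := by
  have balance := h.weight_link_balance (i := r + 2) (j := r + 2 + 1) (by simp) (by simp) (by simp)
    (h.pos _ (by omega)) (h.pos _ (by omega))
  rw [erase_erase_range, weight_link_last] at balance
  have hgain := card_link_sub_mul_le E (range (r + 2)) (t := {r + 2}) (t' := {r + 3}) (x := x) 2
    (fun p hp hE ↦ by
      have hp := (mem_powersetCard.1 hp).1
      exact h.compressed.insert_mem_of_lt (by omega) (fun h ↦ by simpa using hp h)
        (fun h ↦ by simpa using hp h) hE)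
    fun p hp _ ↦ mul_le_prod h.antitone h.nonneg hp
  have h₁ : (#(link E (range (r + 2)) {r + 2} 2) : ℝ) + #(colink E (range (r + 2)) {r + 2} 2) =
      #(link E (range (r + 2)) {r + 3} 2) + #(colink E (range (r + 2)) {r + 3} 2) := by
    exact_mod_cast (card_link_add_card_colink ..).trans (card_link_add_card_colink ..).symm
  calc _ = ((#(link E (range (r + 2)) {r + 2} 2) : ℝ) - #(link E (range (r + 2)) {r + 3} 2)) *
        (x r * x (r + 1)) := by congr 1; linarith
    _ ≤ _ := hgain
    _ = _ := by linear_combination balance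

end LastPair

section CliqueOnHead

variable {E : Finset (Finset ℕ)} {x : ℕ → ℝ} {r : ℕ}

/-- Apart from triples through both of the last two vertices, every triple missing from `E` contains
`r + 3`, and by `card_coneighbors_le` these triples are at least as many as the edges through both;
the balance of `r + 2` and `r + 3` turns this count into the inequality. -/
theorem IsShiftedOptimum.mul_le_of_clique
    (h : IsShiftedOptimum (r + 4) #(twinGraph r) E x) (hB : (coneighbors E (r + 2)).Nonempty)
    (hclique : powersetCard 3 (range (r + 3)) ⊆ E) :
    x r * x (r + 2) ≤ x 0 * (x (r + 2) - x (r + 3)) := by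
  have hcount := card_coneighbors_le h.edges (h.card_le.trans_eq (card_twinGraph r))
  have hbalance := h.card_colink_sub_mul_le
  have hrange : range (r + 2) ⊆ range (r + 3) := range_subset_range.2 (by omega)
  have h₀ : colink E (range (r + 2)) ∅ 3 = ∅ :=
    colink_eq_empty_of_powersetCard_subset (by simpa using hclique) (by simp) hrange (by simp)
  have h₁ : colink E (range (r + 2)) {r + 2} 2 = ∅ :=
    colink_eq_empty_of_powersetCard_subset (by simpa using hclique) (by simp) hrange (by simp)
  rw [h₁, h.sum_coneighbors, card_empty, Nat.cast_zero, sub_zero] at hbalance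
  rw [h₀, h₁, card_empty, zero_add, zero_add] at hcount
  have hcount' : (#(coneighbors E (r + 2)) : ℝ) ≤ #(colink E (range (r + 2)) {r + 3} 2) := by
    exact_mod_cast hcount
  have hB' : (0 : ℝ) < #(coneighbors E (r + 2)) := by exact_mod_cast card_pos.2 hB
  have hr := h.nonneg r
  have hw := h.nonneg (r + 2)
  refine le_of_mul_le_mul_left ?_ hB'
  calc #(coneighbors E (r + 2)) * (x r * x (r + 2))
      ≤ #(colink E (range (r + 2)) {r + 3} 2) * (x r * x (r + 1)) := by
        gcongr
        exact h.antitone (by omega)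
    _ ≤ _ := hbalance
    _ = _ := by ring

theorem IsShiftedOptimum.sub_lt_of_clique {M : ℕ} (hr : 2 ≤ r)
    (h : IsShiftedOptimum (r + 4) M E x) (hB : (coneighbors E (r + 2)).Nonempty)
    (hclique : powersetCard 3 (range (r + 3)) ⊆ E) : x 0 - x r < x (r + 3) := by
  set s := ((range (r + 4)).erase 0).erase r with hs
  have hy := h.pos (r + 3) (by omega)
  have hys : r + 3 ∈ s := by simp [hs]
  have hsum : ∑ i ∈ s, x i = 1 - x 0 - x r :=
    h.sum_erase_erase (by simp) (by simp) (by omega)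
  have hsum' : ∑ i ∈ s.erase (r + 3), x i = 1 - x 0 - x r - x (r + 3) := by
    rw [← hsum, ← sum_erase_add s x hys, add_sub_cancel_right]
  have hsum_pos : 0 < 1 - x 0 - x r := hsum ▸ sum_pos
    (fun i hi ↦ h.pos_of_mem i (mem_of_mem_erase (mem_of_mem_erase hi))) ⟨_, hys⟩
  have hempty : colink E (s.erase (r + 3)) {r} 2 = ∅ :=
    colink_eq_empty_of_powersetCard_subset (K := range (r + 3)) (by simpa using hclique) (by simp)
      (fun i hi ↦ by simp only [hs, mem_erase, mem_range] at hi ⊢; omega) (by simp [hs])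
  have hmissing : weight (colink E s {r} 2) x ≤ x (r + 3) * (1 - x 0 - x r - x (r + 3)) := by
    rw [← insert_erase hys, weight_colink_insert (by simp), hempty, weight, sum_empty, zero_add,
      ← hsum', ← weight_powersetCard_one]
    exact mul_le_mul_of_nonneg_left (weight_mono h.nonneg (colink_subset ..)) hy.le
  have hfirst := h.sub_mul_eq_weight_colink h.pos_of_mem (v := 0) (i := r) (by simp) (by simp)
    (by omega) fun _ ↦ h.compressed.insert_mem (h.compressed.zero_mem_coneighbors hB)
  refine lt_of_mul_lt_mul_right ?_ hsum_pos.le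
  linarith [mul_pos hy hy]

theorem IsShiftedOptimum.not_clique (hr : 2 ≤ r)
    (h : IsShiftedOptimum (r + 4) #(twinGraph r) E x) (hB : (coneighbors E (r + 2)).Nonempty) :
    ¬ powersetCard 3 (range (r + 3)) ⊆ E := fun hclique ↦ by
  have hmul := h.mul_le_of_clique hB hclique
  have hsub := h.sub_lt_of_clique hr hB hclique
  have hw := h.pos (r + 2) (by omega)
  have hy := h.pos (r + 3) (by omega)
  have hlt : x 0 * x (r + 3) < x (r + 2) * x (r + 3) := by
    linarith [mul_lt_mul_of_pos_right hsub hw]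
  exact (lt_of_mul_lt_mul_right hlt hy.le).not_ge (h.antitone (Nat.zero_le _))

end CliqueOnHead

section NoCliqueOnHead

variable {E : Finset (Finset ℕ)} {x : ℕ → ℝ} {M r : ℕ} {f : Finset ℕ}

theorem IsShiftedOptimum.weight_zero_le (h : IsShiftedOptimum (r + 4) M E x)
    (hweight : completeValue (r + 3) ≤ weight E x) : x 0 ≤ 1 / (r + 2) := by
  have hmem : 0 ∈ range (r + 4) := by simp
  have hle := h.six_mul_weight_le h.pos_of_mem hmem
  have hsum : ∑ i ∈ (range (r + 4)).erase 0, x i = 1 - x 0 := by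
    rw [← h.sum_eq, ← sum_erase_add _ _ hmem, add_sub_cancel_right]
  have hsq := sq_sum_le_card_mul_sum_sq (s := (range (r + 4)).erase 0) (f := x)
  rw [hsum, card_erase_of_mem hmem, card_range, Nat.add_sub_assoc (by norm_num)] at hsq
  push_cast at hsq
  have hvalue := (six_mul_completeValue r).symm.trans_le
    ((mul_le_mul_of_nonneg_left hweight (by norm_num)).trans hle)
  rw [div_le_iff₀ (by positivity)] at hvalue
  have hmul : ((r : ℝ) + 2) * (r + 1) ≤ (r + 2) * ((r + 3) * (1 - x 0) ^ 2) := by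
    linarith [mul_le_mul_of_nonneg_left hsq (show (0 : ℝ) ≤ r + 3 by positivity)]
  have _ := le_of_mul_le_mul_left hmul (by positivity)
  rw [le_div_iff₀ (by positivity)]
  by_contra! hlt
  have hx₀ : 0 ≤ 1 - x 0 := hsum ▸ sum_nonneg fun i _ ↦ h.nonneg i
  have hsq_lt : ((1 - x 0) * (r + 2)) ^ 2 < (r + 1 : ℝ) ^ 2 :=
    pow_lt_pow_left₀ (by linarith) (by positivity) two_ne_zero
  nlinarith

theorem IsShiftedOptimum.last_add_le (h : IsShiftedOptimum (r + 4) M E x) :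
    x (r + 2) + x (r + 3) ≤ 2 / (r + 4) := by
  have hsum := h.sum_eq
  rw [sum_range_succ, sum_range_succ] at hsum
  have hhead : (r + 2) * x (r + 2) ≤ ∑ i ∈ range (r + 2), x i := by
    simpa using card_nsmul_le_sum (range (r + 2)) x (x (r + 2)) fun i hi ↦
      h.antitone (mem_range.1 hi).le
  have hlast : x (r + 3) ≤ x (r + 2) := h.antitone (by omega)
  rw [le_div_iff₀ (by positivity)]
  nlinarith [mul_le_mul_of_nonneg_left hlast (show (0 : ℝ) ≤ r + 2 by positivity)]

theorem Compressed.coneighbors_subset_range (hE : Compressed E)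
    (hf : f ∈ powersetCard 3 (range (r + 3))) (hfE : f ∉ E) :
    coneighbors E (r + 2) ⊆ range r := fun i hi ↦ by
  obtain ⟨hir, hi⟩ := mem_coneighbors.1 hi
  by_contra hri
  obtain ⟨hfr, hcard⟩ := mem_powersetCard.1 hf
  obtain ⟨a, b, c, hab, hbc, rfl⟩ := exists_sorted_triple hcard
  have hc := mem_range.1 (hfr (show c ∈ ({a, b, c} : Finset ℕ) by simp))
  rw [mem_range] at hri
  exact hfE (hE.mono_triple hab hbc hir (by omega) (by omega) (by omega) (by omega) hi)

theorem IsShiftedOptimum.mul_le_of_notMem (h : IsShiftedOptimum (r + 4) M E x)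
    (hB : (coneighbors E (r + 2)).Nonempty) (hf : f ∈ powersetCard 3 (range (r + 3)))
    (hfE : f ∉ E) : x r * x (r + 1) ≤ x 0 * x (r + 3) := by
  have hedge := (mem_coneighbors.1 (h.compressed.zero_mem_coneighbors hB)).2
  have hexchange := h.prod_le_prod hedge hfE
    (powersetCard_mono (range_subset_range.2 (by omega)) hf)
  rw [prod_triple x (by omega) (by omega)] at hexchange
  refine le_of_mul_le_mul_left ?_ (h.pos (r + 2) (by omega))
  calc x (r + 2) * (x r * x (r + 1)) = x r * x (r + 1) * x (r + 2) := by ring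
    _ ≤ x 0 * x (r + 2) * x (r + 3) := (mul_mul_le_prod h.antitone h.nonneg hf).trans hexchange
    _ = x (r + 2) * (x 0 * x (r + 3)) := by ring

theorem IsShiftedOptimum.isWeighting_merge (h : IsShiftedOptimum (r + 4) M E x) :
    IsWeighting (range (r + 3)) (merge x (r + 2) (r + 3)) := by
  have hmerge : IsWeighting (range (r + 4)) (merge x (r + 2) (r + 3)) :=
    h.toIsWeighting.merge (by simp) (by simp) (by simp)
  refine hmerge.of_eq_zero fun i hi ↦ ?_
  rcases eq_or_ne i (r + 3) with rfl | hne
  · exact merge_right ..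
  · exact hmerge.eq_zero i (by simp only [mem_range] at hi ⊢; omega)

theorem weight_eq_weight_link_head (hE : E ⊆ powersetCard 3 (range (r + 4)))
    (hx : x (r + 3) = 0) : weight E x = weight (link E (range (r + 3)) ∅ 3) x := by
  rw [weight_split_vertex hE (self_mem_range_succ (r + 3)), hx, zero_mul, add_zero, range_add_one,
    erase_insert notMem_range_self]

theorem IsShiftedOptimum.deviation_merge_add_le (h : IsShiftedOptimum (r + 4) M E x)
    (hweight : completeValue (r + 3) ≤ weight E x) :
    deviation (range (r + 3)) (merge x (r + 2) (r + 3)) +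
        6 * weight (colink E (range (r + 3)) ∅ 3) (merge x (r + 2) (r + 3)) ≤
      6 * (x (r + 3) ^ 2 * (#(coneighbors E (r + 2)) * x 0)) := by
  have hdev := six_mul_weight_add_deviation (card_range (r + 3)) h.isWeighting_merge.sum_eq
  have hlink := weight_link_add_weight_colink E (range (r + 3)) ∅ 3 (merge x (r + 2) (r + 3))
  have hmerge : weight E (merge x (r + 2) (r + 3)) = weight E x - _ := h.weight_merge_last
  rw [h.sum_coneighbors, weight_eq_weight_link_head h.edges (merge_right ..)] at hmerge
  linarith

theorem IsShiftedOptimum.card_colink_mul_le (h : IsShiftedOptimum (r + 4) M E x) :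
    (#(colink E (range (r + 2)) {r + 2} 2) + #(colink E (range (r + 2)) ∅ 3) / 2 : ℝ) *
        ((x (r + 2) + x (r + 3)) * (x r * x (r + 1))) ≤
      weight (colink E (range (r + 3)) ∅ 3) (merge x (r + 2) (r + 3)) := by
  have agree (t : Finset ℕ) (k : ℕ) :
      weight (colink E (range (r + 2)) t k) (merge x (r + 2) (r + 3)) =
        weight (colink E (range (r + 2)) t k) x := weight_congr fun p hp i hi ↦ by
    have := mem_range.1 ((mem_powersetCard.1 (colink_subset _ _ _ _ hp)).1 hi)
    exact merge_of_ne x (by omega) (by omega)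
  have hpairs : #(colink E (range (r + 2)) {r + 2} 2) * (x r * x (r + 1)) ≤
      weight (colink E (range (r + 2)) {r + 2} 2) x :=
    card_mul_le_weight fun p hp ↦ mul_le_prod h.antitone h.nonneg (colink_subset _ _ _ _ hp)
  have htriples : #(colink E (range (r + 2)) ∅ 3) * (x r * x (r + 1) * x (r + 2)) ≤
      weight (colink E (range (r + 2)) ∅ 3) x :=
    card_mul_le_weight fun p hp ↦ mul_mul_le_prod h.antitone h.nonneg
      (powersetCard_mono (range_subset_range.2 (by omega)) (colink_subset _ _ _ _ hp))
  have hz : 0 ≤ x (r + 2) + x (r + 3) := add_nonneg (h.nonneg _) (h.nonneg _)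
  have hlast : x (r + 3) ≤ x (r + 2) := h.antitone (by omega)
  have hproduct : 0 ≤ #(colink E (range (r + 2)) ∅ 3) * (x r * x (r + 1)) :=
    mul_nonneg (Nat.cast_nonneg _) (mul_nonneg (h.nonneg _) (h.nonneg _))
  rw [range_add_one (n := r + 2), weight_colink_insert notMem_range_self,
    merge_left x (by omega), agree, agree, insert_empty_eq]
  linarith [mul_le_mul_of_nonneg_left hpairs hz, mul_le_mul_of_nonneg_left hlast hproduct]

theorem IsShiftedOptimum.deviation_merge_le
    (h : IsShiftedOptimum (r + 4) #(twinGraph r) E x)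
    (hweight : completeValue (r + 3) ≤ weight E x) :
    3 * #(coneighbors E (r + 2)) * (x (r + 2) + x (r + 3)) * (x r * x (r + 1)) +
        deviation (range (r + 3)) (merge x (r + 2) (r + 3)) ≤
      3 * #(coneighbors E (r + 2)) * x 0 * (x (r + 2) ^ 2 + x (r + 3) ^ 2) := by
  have hcount : (#(coneighbors E (r + 2)) : ℝ) ≤ #(colink E (range (r + 2)) ∅ 3) +
      #(colink E (range (r + 2)) {r + 2} 2) + #(colink E (range (r + 2)) {r + 3} 2) := by
    exact_mod_cast card_coneighbors_le h.edges (h.card_le.trans_eq (card_twinGraph r))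
  have hbalance := h.card_colink_sub_mul_le
  rw [h.sum_coneighbors] at hbalance
  have hproduct : 0 ≤ x r * x (r + 1) := mul_nonneg (h.nonneg _) (h.nonneg _)
  have hz : 0 ≤ 3 * (x (r + 2) + x (r + 3)) :=
    mul_nonneg (by norm_num) (add_nonneg (h.nonneg _) (h.nonneg _))
  have hmissing : (#(coneighbors E (r + 2)) - 2 * #(colink E (range (r + 2)) {r + 2} 2) -
      #(colink E (range (r + 2)) ∅ 3)) * (x r * x (r + 1)) ≤
      (x (r + 2) - x (r + 3)) * (#(coneighbors E (r + 2)) * x 0) :=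
    (mul_le_mul_of_nonneg_right (by linarith) hproduct).trans hbalance
  linarith [mul_le_mul_of_nonneg_left hmissing hz, h.deviation_merge_add_le hweight,
    h.card_colink_mul_le]

theorem IsShiftedOptimum.le_deviation_merge (h : IsShiftedOptimum (r + 4) M E x)
    (hweight : completeValue (r + 3) ≤ weight E x) (hB : coneighbors E (r + 2) ⊆ range r) :
    (3 - 4 / ((r : ℝ) + 3) - 2 / (r + 2)) *
          (#(coneighbors E (r + 2)) * (x 0 - 1 / (r + 3)) ^ 2 +
            ((x r - 1 / (r + 3)) ^ 2 + (x (r + 1) - 1 / (r + 3)) ^ 2)) +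
        (3 - 4 / (r + 3) - 4 / (r + 4)) * (x (r + 2) + x (r + 3) - 1 / (r + 3)) ^ 2 ≤
      deviation (range (r + 3)) (merge x (r + 2) (r + 3)) := by
  set κ : ℝ := 3 - 4 / (r + 3) - 2 / (r + 2)
  have hκ₀ : 0 ≤ κ := by
    have h₃ : 4 / ((r : ℝ) + 3) ≤ 4 / 3 := by gcongr; linarith [r.cast_nonneg (α := ℝ)]
    have h₂ : 2 / ((r : ℝ) + 2) ≤ 2 / 2 := by gcongr; linarith [r.cast_nonneg (α := ℝ)]
    linarith
  have term : ∀ i < r + 2, κ * (x i - 1 / (r + 3)) ^ 2 ≤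
      (merge x (r + 2) (r + 3) i - 1 / (r + 3)) ^ 2 *
        (3 - 4 / (r + 3) - 2 * merge x (r + 2) (r + 3) i) := fun i hi ↦ by
    rw [merge_of_ne x (by omega) (by omega), mul_comm]
    have hxi := (h.antitone i.zero_le).trans (h.weight_zero_le hweight)
    refine mul_le_mul_of_nonneg_left ?_ (sq_nonneg _)
    linarith [show 2 / ((r : ℝ) + 2) = 2 * (1 / (r + 2)) by ring]
  have last_term : (3 - 4 / ((r : ℝ) + 3) - 4 / (r + 4)) *
      (x (r + 2) + x (r + 3) - 1 / (r + 3)) ^ 2 ≤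
      (x (r + 2) + x (r + 3) - 1 / (r + 3)) ^ 2 *
        (3 - 4 / (r + 3) - 2 * (x (r + 2) + x (r + 3))) := by
    rw [mul_comm]
    refine mul_le_mul_of_nonneg_left ?_ (sq_nonneg _)
    linarith [h.last_add_le, show 4 / ((r : ℝ) + 4) = 2 * (2 / (r + 4)) by ring]
  have head : κ * (#(coneighbors E (r + 2)) * (x 0 - 1 / (r + 3)) ^ 2) ≤
      ∑ i ∈ range r, (merge x (r + 2) (r + 3) i - 1 / (r + 3)) ^ 2 *
        (3 - 4 / (r + 3) - 2 * merge x (r + 2) (r + 3) i) :=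
    calc _ = ∑ i ∈ coneighbors E (r + 2), κ * (x i - 1 / (r + 3)) ^ 2 := by
          rw [sum_congr rfl fun i hi ↦ by rw [h.eq_of_mem_coneighbors hi], sum_const, nsmul_eq_mul]
          ring
      _ ≤ ∑ i ∈ range r, κ * (x i - 1 / (r + 3)) ^ 2 :=
        sum_le_sum_of_subset_of_nonneg hB fun i _ _ ↦ mul_nonneg hκ₀ (sq_nonneg _)
      _ ≤ _ := sum_le_sum fun i hi ↦ term i ((mem_range.1 hi).trans (by omega))
  rw [deviation, card_range]
  push_cast
  rw [sum_range_succ, sum_range_succ, sum_range_succ, merge_left x (by omega)]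
  linarith [term r (by omega), term (r + 1) (by omega)]

theorem IsShiftedOptimum.powersetCard_subset (hr : 2 ≤ r)
    (h : IsShiftedOptimum (r + 4) #(twinGraph r) E x)
    (hweight : completeValue (r + 3) ≤ weight E x) (hB : (coneighbors E (r + 2)).Nonempty) :
    powersetCard 3 (range (r + 3)) ⊆ E := fun f hf ↦ by
  by_contra hfE
  have hBr := h.compressed.coneighbors_subset_range hf hfE
  have hcard : #(coneighbors E (r + 2)) ≤ r := by simpa using card_le_card hBr
  have hcard' : (#(coneighbors E (r + 2)) : ℝ) ≤ r := by exact_mod_cast hcard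
  have hb : (1 : ℝ) ≤ #(coneighbors E (r + 2)) := by exact_mod_cast card_pos.2 hB
  have hb' : (#(coneighbors E (r + 2)) : ℝ) ≤ 2 ∨ (3 : ℝ) ≤ #(coneighbors E (r + 2)) := by
    exact_mod_cast Nat.lt_or_ge #(coneighbors E (r + 2)) 3 |>.imp_left Nat.le_of_lt_succ
  have hr' : (2 : ℝ) ≤ r := by exact_mod_cast hr
  have hn : (r : ℝ) + 3 - 1 = r + 2 := by ring
  have hn' : (r : ℝ) + 3 + 1 = r + 4 := by ring
  refine twin_absurd_scaled (n := r + 3) (by linarith) hb hb' (by linarith) ?_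
    (h.antitone r.zero_le) (h.antitone r.le_succ) (h.antitone (r + 1).le_succ)
    (h.antitone (r + 2).le_succ) (h.pos (r + 3) (by omega)) (h.mul_le_of_notMem hB hf hfE) ?_
  · rw [hn]
    exact h.weight_zero_le hweight
  · rw [hn, hn']
    linarith [h.deviation_merge_le hweight, h.le_deviation_merge hweight hBr]

theorem IsShiftedOptimum.coneighbors_eq_empty (hr : 2 ≤ r)
    (h : IsShiftedOptimum (r + 4) #(twinGraph r) E x)
    (hweight : completeValue (r + 3) ≤ weight E x) : coneighbors E (r + 2) = ∅ := by
  by_contra hB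
  have hB := nonempty_iff_ne_empty.2 hB
  exact h.not_clique hr hB (h.powersetCard_subset hr hweight hB)

end NoCliqueOnHead

/-! ### Cliques in optimal hypergraphs -/

section Clique

variable {α : Type*} {U S : Finset α} {k M r : ℕ} {E T : Finset (Finset α)} {x : α → ℝ}

theorem IsOptimal.subset_of_prod_lt (h : IsOptimal k U M E x) (hT : T ⊆ powersetCard k U)
    (hcard : #T ≤ M) (hpos : ∀ f ∈ T, 0 < ∏ i ∈ f, x i)
    (hlt : ∀ f ∈ T, ∀ e ∈ powersetCard k U, e ∉ T → ∏ i ∈ e, x i < ∏ i ∈ f, x i) : T ⊆ E := by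
  by_contra hne
  obtain ⟨f, hf, hfE⟩ := not_subset.1 hne
  have hET : E ⊆ T := fun e he ↦ by
    by_contra heT
    exact (hlt f hf e (h.edges he) heT).not_ge (h.prod_le_prod he hfE (hT hf))
  have gain : weight E x < weight T x := sum_lt_sum_of_subset hET hf hfE (hpos f hf)
    fun e he _ ↦ (hpos e he).le
  exact gain.not_ge (h.weight_le ⟨h.toIsWeighting, hT, hcard⟩)

theorem IsOptimal.powersetCard_subset (hr : 2 ≤ r) (hM : (r + 3).choose 3 ≤ M)
    (h : IsOptimal 3 U M E x) (hS : #S = r + 3) (hx : IsWeighting S x)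
    (hweight : completeValue (r + 3) ≤ weight E x) :
    weight E x = completeValue (r + 3) ∧ powersetCard 3 S ⊆ E := by
  classical
  have hES : {e ∈ E | e ⊆ S} ⊆ powersetCard 3 S := fun e he ↦
    mem_powersetCard.2 ⟨(mem_filter.1 he).2, (mem_powersetCard.1 (h.edges (mem_filter.1 he).1)).2⟩
  obtain ⟨hvalue, uniform⟩ :=
    hx.uniform_of_completeValue_le hr hS hES (by rwa [weight_filter_subset hx.eq_zero])
  rw [weight_filter_subset hx.eq_zero] at hvalue
  have pos : ∀ i ∈ S, 0 < x i := fun i hi ↦ by rw [uniform i hi]; positivity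
  have prod_pos' : ∀ f ∈ powersetCard 3 S, 0 < ∏ i ∈ f, x i := fun f hf ↦
    prod_pos fun i hi ↦ pos i ((mem_powersetCard.1 hf).1 hi)
  have hSU : S ⊆ U := fun i hi ↦ by
    by_contra hiU
    exact (pos i hi).ne' (h.eq_zero i hiU)
  refine ⟨hvalue, h.subset_of_prod_lt (powersetCard_mono hSU)
    (by rwa [card_powersetCard, hS]) prod_pos' fun f hf e he heS ↦ ?_⟩
  obtain ⟨i, hi, hiS⟩ :=
    not_subset.1 fun hsub ↦ heS (mem_powersetCard.2 ⟨hsub, (mem_powersetCard.1 he).2⟩)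
  exact (prod_eq_zero hi (hx.eq_zero i hiS)).trans_lt (prod_pos' f hf)

end Clique

section AntitoneOptimum

variable {E : Finset (Finset ℕ)} {x : ℕ → ℝ} {N r : ℕ}

theorem IsShiftedOptimum.merge_uniform (hr : 2 ≤ r)
    (h : IsShiftedOptimum (r + 4) #(twinGraph r) E x)
    (hweight : completeValue (r + 3) ≤ weight E x) :
    weight E x = completeValue (r + 3) ∧
      ∀ i ∈ range (r + 3), merge x (r + 2) (r + 3) i = 1 / (r + 3) := by
  have hmerge := h.weight_merge_last
  rw [h.coneighbors_eq_empty hr hweight, sum_empty, mul_zero, sub_zero,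
    weight_eq_weight_link_head h.edges (merge_right ..)] at hmerge
  rw [← hmerge] at hweight ⊢
  exact h.isWeighting_merge.uniform_of_completeValue_le hr (card_range _) (link_subset ..) hweight

theorem prod_lt_of_notMem_twinGraph (hzero : ∀ i ∉ range (r + 4), x i = 0)
    (hx : ∀ i < r + 2, x i = 1 / (r + 3)) (hlast : x (r + 2) < 1 / (r + 3))
    (hpos : 0 < x (r + 3)) {e : Finset ℕ} (hcard : #e = 3) (he : e ∉ twinGraph r) :
    ∏ i ∈ e, x i < x r * x (r + 1) * x (r + 3) := by
  have _ : (0 : ℝ) < 1 / (r + 3) := by positivity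
  rw [hx r (by omega), hx (r + 1) (by omega)]
  by_cases hsub : e ⊆ range (r + 4)
  · obtain ⟨a, b, c, hab, hbc, rfl⟩ := exists_sorted_triple hcard
    obtain ⟨hb, hc'⟩ : r + 2 ∈ ({a, b, c} : Finset ℕ) ∧ r + 3 ∈ ({a, b, c} : Finset ℕ) := by
      by_contra hne
      exact he (mem_filter.2 ⟨mem_powersetCard.2 ⟨hsub, hcard⟩, hne⟩)
    have hlt : c < r + 4 := mem_range.1 (hsub (by simp))
    simp only [mem_insert, mem_singleton] at hb hc'
    obtain rfl : c = r + 3 := by omega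
    obtain rfl : b = r + 2 := by omega
    rw [prod_triple x hab hbc, hx a hab]
    gcongr
  · obtain ⟨i, hi, hir⟩ := not_subset.1 hsub
    rw [prod_eq_zero hi (hzero i hir)]
    positivity

theorem IsOptimal.twinGraph_subset (hN : r + 4 ≤ N)
    (h : IsOptimal 3 (range N) #(twinGraph r) E x) (hx : Antitone x)
    (hzero : ∀ i ∉ range (r + 4), x i = 0) (hpos : 0 < x (r + 3))
    (hmerge : ∀ i ∈ range (r + 3), merge x (r + 2) (r + 3) i = 1 / (r + 3)) :
    twinGraph r ⊆ E := by
  have uniform : ∀ i < r + 2, x i = 1 / (r + 3) := fun i hi ↦ by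
    rw [← hmerge i (mem_range.2 (by omega)), merge_of_ne x (by omega) (by omega)]
  have hlast : x (r + 2) < 1 / (r + 3) := by
    rw [← hmerge (r + 2) (by simp), merge_left x (by omega)]
    exact lt_add_of_pos_right _ hpos
  have hle : ∀ f ∈ twinGraph r, x r * x (r + 1) * x (r + 3) ≤ ∏ i ∈ f, x i := fun f hf ↦
    mul_mul_le_prod_of_mem_twinGraph hx h.nonneg hf
  have hpos' : ∀ i ≤ r + 3, 0 < x i := fun i hi ↦ hpos.trans_le (hx hi)
  refine h.subset_of_prod_lt ((filter_subset _ _).trans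
    (powersetCard_mono (range_subset_range.2 hN))) le_rfl (fun f hf ↦ (hle f hf).trans_lt' ?_)
    fun f hf e he heT ↦ (hle f hf).trans_lt' ?_
  · exact mul_pos (mul_pos (hpos' r (by omega)) (hpos' (r + 1) (by omega))) hpos
  · exact prod_lt_of_notMem_twinGraph hzero uniform hlast hpos (mem_powersetCard.1 he).2 heT

theorem powersetCard_subset_twinGraph (r : ℕ) : powersetCard 3 (range (r + 3)) ⊆ twinGraph r :=
  fun f hf ↦ by
    refine mem_filter.2 ⟨powersetCard_mono (range_subset_range.2 (by omega)) hf, fun hl ↦ ?_⟩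
    simpa using (mem_powersetCard.1 hf).1 hl.2

theorem exists_pos_and_eq_zero (hx : Antitone x) (h : IsWeighting (range N) x) :
    ∃ k ≤ N, (∀ i < k, 0 < x i) ∧ ∀ i ∉ range k, x i = 0 := by
  classical
  have hN : ∃ k, x k = 0 := ⟨N, h.eq_zero N notMem_range_self⟩
  refine ⟨Nat.find hN, Nat.find_min' hN (h.eq_zero N notMem_range_self), fun i hi ↦ ?_,
    fun i hi ↦ ?_⟩
  · exact (h.nonneg i).lt_of_ne' (Nat.find_min hN hi)
  · have hle := hx (not_lt.1 (mt mem_range.2 hi))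
    exact le_antisymm (hle.trans_eq (Nat.find_spec hN)) (h.nonneg i)

theorem IsOptimal.exists_isShiftedOptimum {k M : ℕ} (h : IsOptimal 3 (range N) M E x)
    (hx : Antitone x) (hk : k ≤ N) (hpos : ∀ i < k, 0 < x i) (hzero : ∀ i ∉ range k, x i = 0) :
    ∃ E', IsShiftedOptimum k M E' x ∧ weight E' x = weight E x := by
  obtain ⟨E', hopt, hcomp, hE'⟩ := h.exists_compressed hx
  exact ⟨_, ⟨hopt.restrict (range_subset_range.2 hk) hzero, hpos, hx, hcomp.filter_range k⟩,
    (weight_filter_subset hzero).trans hE'⟩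

theorem IsOptimal.powersetCard_subset_of_antitone (hr : 2 ≤ r)
    (h : IsOptimal 3 (range N) #(twinGraph r) E x) (hx : Antitone x)
    (hweight : completeValue (r + 3) ≤ weight E x) :
    weight E x = completeValue (r + 3) ∧ powersetCard 3 (range (r + 3)) ⊆ E := by
  obtain ⟨k, hkN, hpos, hzero⟩ := exists_pos_and_eq_zero hx h.toIsWeighting
  rcases le_or_gt k (r + 3) with hk | hk
  · exact h.powersetCard_subset hr (by rw [card_twinGraph]; omega) (card_range _)
      (h.toIsWeighting.of_eq_zero fun i hi ↦
        hzero i (mt (@range_subset_range.2 hk i) hi)) hweight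
  obtain ⟨E', hopt, hE'⟩ := h.exists_isShiftedOptimum hx hkN hpos hzero
  rw [← hE'] at hweight ⊢
  rcases le_or_gt (r + 5) k with hk' | hk'
  · obtain ⟨j, rfl⟩ := Nat.exists_eq_add_of_le' (show 2 ≤ k by omega)
    exact absurd hweight (hopt.weight_lt_of_large_support hr (by omega)).not_ge
  obtain rfl : k = r + 4 := by omega
  obtain ⟨hvalue, hmerge⟩ := hopt.merge_uniform hr hweight
  exact ⟨hvalue, (powersetCard_subset_twinGraph r).trans
    (h.twinGraph_subset hkN hx hzero (hpos _ (by omega)) hmerge)⟩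

end AntitoneOptimum

/-! ### Relabelling and the existence of optimal pairs -/

section Relabelling

variable {α β : Type*} {U : Finset α} {k M : ℕ} {E : Finset (Finset α)} {x : α → ℝ}

/-- The image of a family of finite sets under an injection. -/
def mapFamily (φ : α ↪ β) (E : Finset (Finset α)) : Finset (Finset β) :=
  E.map (mapEmbedding φ).toEmbedding

theorem map_mem_mapFamily {φ : α ↪ β} {e : Finset α} : e.map φ ∈ mapFamily φ E ↔ e ∈ E :=
  mem_map' (mapEmbedding φ).toEmbedding

theorem weight_mapFamily (φ : α ↪ β) (E : Finset (Finset α)) (y : β → ℝ) :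
    weight (mapFamily φ E) y = weight E (y ∘ φ) := by
  simp [weight, mapFamily]

theorem IsWeighting.comp {φ : α ↪ β} {y : β → ℝ} (h : IsWeighting (U.map φ) y) :
    IsWeighting U (y ∘ φ) where
  nonneg i := h.nonneg (φ i)
  eq_zero i hi := h.eq_zero (φ i) (mt (mem_map' φ).1 hi)
  sum_eq := by simpa using h.sum_eq

theorem IsWeighting.extend (φ : α ↪ β) (h : IsWeighting U x) :
    IsWeighting (U.map φ) (Function.extend φ x 0) where
  nonneg b := by
    by_cases hb : ∃ a, φ a = b
    · obtain ⟨a, rfl⟩ := hb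
      rw [φ.injective.extend_apply]
      exact h.nonneg a
    · rw [Function.extend_apply' _ _ _ hb, Pi.zero_apply]
  eq_zero b hb := by
    by_cases hb' : ∃ a, φ a = b
    · obtain ⟨a, rfl⟩ := hb'
      rw [φ.injective.extend_apply]
      exact h.eq_zero a (mt (mem_map' φ).2 hb)
    · rw [Function.extend_apply' _ _ _ hb', Pi.zero_apply]
  sum_eq := by
    rw [sum_map, ← h.sum_eq]
    exact sum_congr rfl fun a _ ↦ φ.injective.extend_apply ..

theorem IsOptimal.map (φ : α ↪ β) (h : IsOptimal k U M E x) :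
    IsOptimal k (U.map φ) M (mapFamily φ E) (Function.extend φ x 0) where
  toIsWeighting := h.toIsWeighting.extend φ
  edges := by
    rw [powersetCard_map]
    exact map_subset_map.2 h.edges
  card_le := (card_map _).trans_le h.card_le
  weight_le {E' y} h' := by
    have hE' := h'.edges
    rw [powersetCard_map, subset_map_iff] at hE'
    obtain ⟨F, hF, rfl⟩ := hE'
    have hFM : #F ≤ M := (card_map _).symm.trans_le h'.card_le
    calc weight (mapFamily φ F) y = weight F (y ∘ φ) := weight_mapFamily ..
      _ ≤ weight E x := h.weight_le ⟨h'.toIsWeighting.comp, hF, hFM⟩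
      _ = weight (mapFamily φ E) (Function.extend φ x 0) := by
        rw [weight_mapFamily, Function.extend_comp φ.injective]

theorem powersetCard_subset_of_map {φ : α ↪ β}
    (h : powersetCard k (U.map φ) ⊆ mapFamily φ E) : powersetCard k U ⊆ E := fun e he ↦ by
  refine map_mem_mapFamily.1 (h ?_)
  rw [powersetCard_map]
  exact map_mem_mapFamily.2 he

theorem exists_antitone_extend {V : Type*} [Fintype V] {x : V → ℝ} (hx : ∀ v, 0 ≤ x v) :
    ∃ φ : V ↪ ℕ, univ.map φ = range (Fintype.card V) ∧ Antitone (Function.extend φ x 0) := by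
  let e := Fintype.equivFin V
  let σ := Tuple.sort fun i ↦ -x (e.symm i)
  have hσ : Antitone fun i ↦ x (e.symm (σ i)) := fun i j hij ↦
    neg_le_neg_iff.1 (Tuple.monotone_sort (fun i ↦ -x (e.symm i)) hij)
  let φ : V ↪ ℕ := (e.trans σ.symm).toEmbedding.trans Fin.valEmbedding
  have apply_fin (i : Fin (Fintype.card V)) : Function.extend φ x 0 i = x (e.symm (σ i)) := by
    rw [← φ.injective.extend_apply x 0 (e.symm (σ i))]
    simp [φ]
  have apply_ge {i : ℕ} (hi : Fintype.card V ≤ i) : Function.extend φ x 0 i = 0 :=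
    Function.extend_apply' _ _ _ fun ⟨v, hv⟩ ↦
      ((σ.symm (e v)).isLt.trans_le hi).ne hv
  refine ⟨φ, ?_, fun i j hij ↦ ?_⟩
  · rw [← map_map, map_univ_equiv, Fin.map_valEmbedding_univ, Nat.Iio_eq_range]
  · rcases lt_or_ge j (Fintype.card V) with hj | hj
    · exact (apply_fin ⟨j, hj⟩).trans_le ((hσ (show (⟨i, hij.trans_lt hj⟩ : Fin _) ≤ ⟨j, hj⟩
        from hij)).trans_eq (apply_fin ⟨i, _⟩).symm)
    · rw [apply_ge hj]
      rcases lt_or_ge i (Fintype.card V) with hi | hi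
      · exact (hx _).trans_eq (apply_fin ⟨i, hi⟩).symm
      · exact (apply_ge hi).ge

end Relabelling

section Existence

variable {V : Type*} [Fintype V] {k M r : ℕ} {E : Finset (Finset V)} {x : V → ℝ}

theorem isWeighting_univ_iff : IsWeighting univ x ↔ x ∈ stdSimplex ℝ V :=
  ⟨fun h ↦ ⟨h.nonneg, h.sum_eq⟩, fun h ↦ ⟨h.1, fun i hi ↦ absurd (mem_univ i) hi, h.2⟩⟩

theorem Feasible.exists_isOptimal (h : Feasible k univ M E x) :
    ∃ E' x', IsOptimal k (univ : Finset V) M E' x' := by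
  classical
  have hcont (F : Finset (Finset V)) : Continuous (weight F) := by
    unfold weight
    fun_prop
  choose f hf hmax using fun F ↦ (isCompact_stdSimplex ℝ V).exists_isMaxOn
    ⟨x, isWeighting_univ_iff.1 h.toIsWeighting⟩ (hcont F).continuousOn
  obtain ⟨F, hF, hFmax⟩ := exists_max_image {F ∈ (powersetCard k univ).powerset | #F ≤ M}
    (fun F ↦ weight F (f F)) ⟨E, mem_filter.2 ⟨mem_powerset.2 h.edges, h.card_le⟩⟩
  obtain ⟨hFk, hFM⟩ := mem_filter.1 hF
  refine ⟨F, f F, ⟨isWeighting_univ_iff.2 (hf F), mem_powerset.1 hFk, hFM⟩, fun {E' x'} h' ↦ ?_⟩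
  exact (hmax E' (isWeighting_univ_iff.1 h'.toIsWeighting)).trans
    (hFmax E' (mem_filter.2 ⟨mem_powerset.2 h'.edges, h'.card_le⟩))

theorem IsOptimal.exists_clique (hr : 2 ≤ r)
    (h : IsOptimal 3 (univ : Finset V) #(twinGraph r) E x)
    (hweight : completeValue (r + 3) ≤ weight E x) :
    weight E x = completeValue (r + 3) ∧ ∃ S, #S = r + 3 ∧ powersetCard 3 S ⊆ E := by
  obtain ⟨φ, hφ, hanti⟩ := exists_antitone_extend h.nonneg
  have hopt := h.map φ
  have hw : weight (mapFamily φ E) (Function.extend φ x 0) = weight E x := by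
    rw [weight_mapFamily, Function.extend_comp φ.injective]
  rw [hφ] at hopt
  rw [← hw] at hweight ⊢
  obtain ⟨hvalue, hclique⟩ := hopt.powersetCard_subset_of_antitone hr hanti hweight
  have hrange : range (r + 3) ⊆ univ.map φ := by
    rw [hφ, ← powersetCard_sup (range (r + 3)) 2 (by simp)]
    exact (sup_mono (hclique.trans hopt.edges)).trans
      (Finset.sup_le fun e he ↦ (mem_powersetCard.1 he).1)
  obtain ⟨S, -, hS⟩ := subset_map_iff.1 hrange
  rw [hS] at hclique
  exact ⟨hvalue, S, by rw [← card_map φ, ← hS, card_range], powersetCard_subset_of_map hclique⟩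

/-- The value of an optimal pair is exactly that of the complete graph, so a pair that attains it is
itself optimal. -/
theorem Feasible.exists_clique (hr : 2 ≤ r)
    (h : Feasible 3 (univ : Finset V) #(twinGraph r) E x)
    (hweight : completeValue (r + 3) ≤ weight E x) :
    ∃ S, #S = r + 3 ∧ powersetCard 3 S ⊆ E := by
  obtain ⟨E', x', hopt⟩ := h.exists_isOptimal
  obtain ⟨hvalue, -⟩ := hopt.exists_clique hr (hweight.trans (hopt.weight_le h))
  exact (IsOptimal.exists_clique hr
    ⟨h, fun h' ↦ (hopt.weight_le h').trans (hvalue.trans_le hweight)⟩ hweight).2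

end Existence

/-! ### Lagrangians of `3`-graphs -/

theorem nonempty_of_card_edges_pos {V : Type*} {k : ℕ} (hk : 0 < k)
    (G : UniformGraph V k) (hG : 0 < #G.edges) : Nonempty V := by
  obtain ⟨e, he⟩ := card_pos.1 hG
  obtain ⟨v, -⟩ := card_pos.1 (hk.trans_eq (G.card_edge e he).symm)
  exact ⟨v⟩

section Lagrangian

variable {V : Type*} [Fintype V] {r : ℕ}

theorem completeValue_le_lagrangian_complete [Nonempty V] :
    completeValue (Fintype.card V) ≤ (UniformGraph.complete V 3).lagrangian := by
  refine (UniformGraph.complete V 3).isGreatest_lagrangian.2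
    ⟨fun _ ↦ 1 / (Fintype.card V : ℝ), ⟨fun _ ↦ by positivity, by simp⟩, ?_⟩
  exact weight_powersetCard_uniform (s := univ) fun _ _ ↦ rfl

theorem lagrangian_lt_completeValue [Nonempty V] (hr : 2 ≤ r) {G : UniformGraph V 3}
    (hG : #G.edges ≤ #(twinGraph r)) (hclique : ¬ G.ContainsClique (r + 3)) :
    G.lagrangian < completeValue (r + 3) := by
  obtain ⟨x, hx, hxG⟩ := G.isGreatest_lagrangian.1
  by_contra! hweight
  have hedges : G.edges ⊆ powersetCard 3 univ :=
    subset_powersetCard_univ_iff.2 fun e he ↦ G.card_edge e he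
  have hfeas : Feasible 3 univ #(twinGraph r) G.edges x := ⟨isWeighting_univ_iff.2 hx, hedges, hG⟩
  obtain ⟨S, hS, hSG⟩ := hfeas.exists_clique hr (hweight.trans_eq hxG.symm)
  exact hclique ⟨S, hS, fun e heS he ↦ hSG (mem_powersetCard.2 ⟨heS, he⟩)⟩

end Lagrangian

end HypergraphLagrangian

open HypergraphLagrangian in
theorem corollary1p10_general {V : Type*} [Fintype V] [Nonempty V] (t : ℕ) (ht : 5 ≤ t)
    (G : UniformGraph V 3) (hG : G.edges.card ≤ t.choose 3 + (t - 1).choose 2)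
    (hclique : ¬ G.ContainsClique t) :
    G.lagrangian < (UniformGraph.complete (Fin t) 3).lagrangian := by
  obtain ⟨r, rfl⟩ := Nat.exists_eq_add_of_le' (show 3 ≤ t by omega)
  calc G.lagrangian < completeValue (r + 3) :=
        lagrangian_lt_completeValue (by omega) (hG.trans_eq (card_twinGraph r).symm) hclique
    _ = completeValue (Fintype.card (Fin (r + 3))) := by rw [Fintype.card_fin]
    _ ≤ _ := completeValue_le_lagrangian_complete

theorem corollary1p10 {V : Type*} [Fintype V] (l m : ℕ) (hl₁ : 6 ≤ l) (hl₂ : l ≤ 13)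
    (hm₁ : (l - 1).choose 3 ≤ m) (hm₂ : m ≤ (l - 1).choose 3 + (l - 2).choose 2)
    (G : UniformGraph V 3) (hG : G.edges.card = m) (hclique : ¬ G.ContainsClique (l - 1)) :
    G.lagrangian < (UniformGraph.complete (Fin (l - 1)) 3).lagrangian := by
  have := HypergraphLagrangian.nonempty_of_card_edges_pos (by norm_num) G
    (hG ▸ (Nat.choose_pos (by omega)).trans_le hm₁)
  exact corollary1p10_general (l - 1) (by omega) G (hG ▸ hm₂) hclique
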